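/- Lines are projective lines in $\mathbb{CP}^3$. A cubic is a surface $F=0$ with $F$ a non-zero homogeneous polynomial of degree $3$, and it is non-singular if $F$ and its four partial derivatives have no common zero in $\mathbb{CP}^3$. For lines $l_1,l_2,l_3,l_4$ meeting a line $k$, write $(l_1,l_2;l_3,l_4)_k$ for the cross ratio of the four intersection points on $k$, normalised so that it equals $t$ when in some inhomogeneous coordinate on $k$ the points are $\infty,0,1,t$. Consider a configuration of seven lines: $b_5,b_6$ are skew, and $a_1,a_2,a_3,a_4,c_{56}$ are five pairwise skew lines, each meeting both $b_5$ and $b_6$. Put $$\alpha=(c_{56},a_1;a_2,a_3)_{b_5},\quad \alpha'=(c_{56},a_1;a_2,a_3)_{b_6},\quad \beta=(c_{56},a_1;a_2,a_4)_{b_5},\quad \beta'=(c_{56},a_1;a_2,a_4)_{b_6}$$ (these are finite, non-zero complex numbers). Call homogeneous coordinates $z_1,z_2,z_3,z_4$ on $\mathbb{CP}^3$ adapted to the configuration if $b_5$ is $z_1=z_3=0$, $b_6$ is $z_2=z_4=0$, the lines $a_1,a_2,c_{56}$ meet $b_5$ in the points $z_2/z_4=0,1,\infty$ respectively, and they meet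 $b_6$ in the points $z_1/z_3=0,1,\infty$ respectively. For $p,p',q,q'\in\mathbb C$ let $$\begin{aligned}P_1(p,p',q,q')={}&(-pqq'+q^2q'+qp'q'-q^2p'q'-qq'^2+pqq'^2)\,z_3z_2^2\\&+\big[(pqp'-q^2p'-pp'q'+q^2p'q'+pq'^2-pqq'^2)z_1+(-qp'+q^2p'+pq'-q^2q'-pq'^2+qq'^2)z_3\big]z_2z_4\\&+(qp'-pqp'-pq'+pqq'+pp'q'-qp'q')\,z_1z_4^2,\\P_2(p,p',q,q')={}&(-qp'+pqp'+pq'-pqq'-pp'q'+qp'q')\,z_2z_3^2\\&+\big[(qp'^2-pqp'^2-p^2q'+pqq'+p^2p'q'-qp'q')z_2+(-p^2p'+qp'+pp'^2-qp'^2-pq'+p^2q')z_4\big]z_1z_3\\&+(p^2p'-pqp'-pp'^2+pqp'^2+pp'q'-p^2p'q')\,z_4z_1^2,\end{aligned}$$ and put $\mathcal C_i=P_i\big(1/\alpha',\,1/\beta',\,1/\alpha,\,1/\beta\big)$ for $i=1,2$. Theorem. For every such configuration adapted coordinates exist, and in any adapted coordinates the following hold. 1. Every linear combination of $\mathcal C_1$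 and $\mathcal C_2$ is homogeneous of degree $3$ (possibly zero) and vanishes on all seven lines. 2. If some non-singular cubic contains all seven lines, then $\mathcal C_1$ and $\mathcal C_2$ are linearly independent, and every cubic containing the seven lines lies in the pencil spanned by $\mathcal C_1$ and $\mathcal C_2$. 3. Any two non-singular cubics in the linear system spanned by $\mathcal C_1$ and $\mathcal C_2$ are projectively isomorphic: some projective transformation of $\mathbb{CP}^3$ carries one onto the other. Moreover, all non-singular cubics arise in this way: every non-singular cubic in $\mathbb{CP}^3$ contains the seven lines of such a configuration and, in adapted coordinates, belongs to the pencil spanned by its $\mathcal C_1$ and $\mathcal C_2$. -/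

import Mathlib

noncomputable section

/-! Throughout, `CP³` is the projective space of `Fin 4 → ℂ`; a projective line is a
two-dimensional linear subspace, and a point is a one-dimensional one. -/

/-- A projective line in `CP³`. -/
def IsProjLine (l : Submodule ℂ (Fin 4 → ℂ)) : Prop :=
  Module.finrank ℂ l = 2

/-- Two projective lines are skew: they have no common point. -/
def SkewLines (l m : Submodule ℂ (Fin 4 → ℂ)) : Prop :=
  l ⊓ m = ⊥

/-- Two projective lines meet: they have a common point. -/
def LinesMeet (l m : Submodule ℂ (Fin 4 → ℂ)) : Prop :=
  l ⊓ m ≠ ⊥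

/-- `t` is the cross ratio of the points in which `l₁, l₂, l₃, l₄` meet the line `k`: in the
inhomogeneous coordinate `x / y` of the point `x • u + y • v` of `k`, these points are
`∞, 0, 1, t`. For points with finite coordinates `x₁, …, x₄` on `k` this is
`(x₁ - x₃) (x₂ - x₄) / ((x₁ - x₄) (x₂ - x₃))`. -/
def IsCrossRatio (k l₁ l₂ l₃ l₄ : Submodule ℂ (Fin 4 → ℂ)) (t : ℂ) : Prop :=
  ∃ u v : Fin 4 → ℂ, LinearIndependent ℂ ![u, v] ∧
    l₁ ⊓ k = Submodule.span ℂ {u} ∧ l₂ ⊓ k = Submodule.span ℂ {v} ∧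
    l₃ ⊓ k = Submodule.span ℂ {u + v} ∧ l₄ ⊓ k = Submodule.span ℂ {t • u + v}

open Classical in
/-- The cross ratio `(l₁, l₂; l₃, l₄)_k`, with the value `0` where there is no finite cross
ratio. -/
def crossRatio (k l₁ l₂ l₃ l₄ : Submodule ℂ (Fin 4 → ℂ)) : ℂ :=
  if h : ∃ t, IsCrossRatio k l₁ l₂ l₃ l₄ t then h.choose else 0

theorem IsCrossRatio.unique {k l₁ l₂ l₃ l₄ : Submodule ℂ (Fin 4 → ℂ)} {s t : ℂ}
    (hs : IsCrossRatio k l₁ l₂ l₃ l₄ s) (ht : IsCrossRatio k l₁ l₂ l₃ l₄ t) : s = t := by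
  obtain ⟨u, v, huv, h1, h2, h3, h4⟩ := hs
  obtain ⟨u', v', huv', h1', h2', h3', h4'⟩ := ht
  have e1 : u' ∈ Submodule.span ℂ {u} := by
    rw [← h1, h1']; exact Submodule.mem_span_singleton_self _
  have e2 : v' ∈ Submodule.span ℂ {v} := by
    rw [← h2, h2']; exact Submodule.mem_span_singleton_self _
  have e3 : u' + v' ∈ Submodule.span ℂ {u + v} := by
    rw [← h3, h3']; exact Submodule.mem_span_singleton_self _
  have e4 : t • u' + v' ∈ Submodule.span ℂ {s • u + v} := by
    rw [← h4, h4']; exact Submodule.mem_span_singleton_self _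
  obtain ⟨p, rfl⟩ := Submodule.mem_span_singleton.1 e1
  obtain ⟨q, rfl⟩ := Submodule.mem_span_singleton.1 e2
  obtain ⟨r, hr⟩ := Submodule.mem_span_singleton.1 e3
  obtain ⟨w, hw⟩ := Submodule.mem_span_singleton.1 e4
  have hp : p ≠ 0 := by
    rintro rfl
    exact huv'.ne_zero 0 (by simp)
  rw [LinearIndependent.pair_iff] at huv
  have k1 := huv (r - p) (r - q) (by
    have h : (r - p) • u + (r - q) • v = r • (u + v) - (p • u + q • v) := by module
    rw [h, hr, sub_self])
  have k2 := huv (w * s - t * p) (w - q) (by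
    have h : (w * s - t * p) • u + (w - q) • v
        = w • (s • u + v) - (t • p • u + q • v) := by module
    rw [h, hw, sub_self])
  have hpq : w = p := by linear_combination k2.2 - k1.2 + k1.1
  have : p * (s - t) = 0 := by linear_combination k2.1 - s * hpq
  rcases mul_eq_zero.1 this with h | h
  · exact absurd h hp
  · exact sub_eq_zero.1 h

theorem IsCrossRatio.crossRatio_eq {k l₁ l₂ l₃ l₄ : Submodule ℂ (Fin 4 → ℂ)} {t : ℂ}
    (ht : IsCrossRatio k l₁ l₂ l₃ l₄ t) : crossRatio k l₁ l₂ l₃ l₄ = t := by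
  have h : ∃ t, IsCrossRatio k l₁ l₂ l₃ l₄ t := ⟨t, ht⟩
  rw [crossRatio, dif_pos h]
  exact h.choose_spec.unique ht

/-- The polynomial `F(e(x))`: the form `F` in the coordinates `z = e x`, rewritten in the
standard coordinates `x` of `CP³`. -/
def pullbackForm (e : (Fin 4 → ℂ) ≃ₗ[ℂ] (Fin 4 → ℂ)) (F : MvPolynomial (Fin 4) ℂ) :
    MvPolynomial (Fin 4) ℂ :=
  MvPolynomial.aeval
    (fun i => ∑ j, MvPolynomial.C (e (Pi.single j 1) i) * MvPolynomial.X j) F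

theorem eval_pullbackForm (e : (Fin 4 → ℂ) ≃ₗ[ℂ] (Fin 4 → ℂ)) (F : MvPolynomial (Fin 4) ℂ)
    (x : Fin 4 → ℂ) :
    MvPolynomial.eval x (pullbackForm e F) = MvPolynomial.eval (e x) F := by
  have hx : ∀ i, ∑ j, e (Pi.single j 1) i * x j = e x i := by
    intro i
    conv_rhs => rw [pi_eq_sum_univ' x, map_sum]
    simp [Finset.sum_apply, mul_comm]
  induction F using MvPolynomial.induction_on with
  | C c => simp [pullbackForm]
  | add p q hp hq => simpa [pullbackForm] using congrArg₂ (· + ·) hp hq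
  | mul_X p i hp =>
    have : pullbackForm e (p * MvPolynomial.X i) = pullbackForm e p *
        ∑ j, MvPolynomial.C (e (Pi.single j 1) i) * MvPolynomial.X j := by
      simp [pullbackForm]
    rw [this]
    simp [hp, hx]

/-- The surface `F = 0` contains the projective line `l`. -/
def ContainsLine (F : MvPolynomial (Fin 4) ℂ) (l : Submodule ℂ (Fin 4 → ℂ)) : Prop :=
  ∀ x ∈ l, MvPolynomial.eval x F = 0

/-- `F = 0` is a cubic surface in `CP³`. -/
def IsCubic (F : MvPolynomial (Fin 4) ℂ) : Prop :=
  F ≠ 0 ∧ F.IsHomogeneous 3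

/-- `F = 0` is a non-singular cubic surface in `CP³`. -/
def IsNonsingularCubic (F : MvPolynomial (Fin 4) ℂ) : Prop :=
  IsCubic F ∧ ∀ x : Fin 4 → ℂ, x ≠ 0 → MvPolynomial.eval x F = 0 →
    ∃ i, MvPolynomial.eval x (MvPolynomial.pderiv i F) ≠ 0

/-- Some projective transformation of `CP³` carries the surface `F = 0` onto the surface
`G = 0`. -/
def ProjectivelyIsomorphic (F G : MvPolynomial (Fin 4) ℂ) : Prop :=
  ∃ g : (Fin 4 → ℂ) ≃ₗ[ℂ] (Fin 4 → ℂ), ∃ c : ℂ, c ≠ 0 ∧ pullbackForm g G = c • F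

section Polynomials

open MvPolynomial

/-- The first explicit cubic; the coordinates `z₁, z₂, z₃, z₄` are `X 0, X 1, X 2, X 3`. -/
def explicitCubicOne (α α' β β' : ℂ) : MvPolynomial (Fin 4) ℂ :=
  (C (-α * β * β' + β ^ 2 * β' + β * α' * β' - β ^ 2 * α' * β' - β * β' ^ 2
      + α * β * β' ^ 2) * X 2) * X 1 ^ 2
  + (C (α * β * α' - β ^ 2 * α' - α * α' * β' + β ^ 2 * α' * β' + α * β' ^ 2
        - α * β * β' ^ 2) * X 0
      + C (-β * α' + β ^ 2 * α' + α * β' - β ^ 2 * β' - α * β' ^ 2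
        + β * β' ^ 2) * X 2) * (X 1 * X 3)
  + (C (β * α' - α * β * α' - α * β' + α * β * β' + α * α' * β'
      - β * α' * β') * X 0) * X 3 ^ 2

/-- The second explicit cubic; the coordinates `z₁, z₂, z₃, z₄` are `X 0, X 1, X 2, X 3`. -/
def explicitCubicTwo (α α' β β' : ℂ) : MvPolynomial (Fin 4) ℂ :=
  (C (-β * α' + α * β * α' + α * β' - α * β * β' - α * α' * β'
      + β * α' * β') * X 1) * X 2 ^ 2
  + (C (β * α' ^ 2 - α * β * α' ^ 2 - α ^ 2 * β' + α * β * β' + α ^ 2 * α' * β'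
        - β * α' * β') * X 1
      + C (-α ^ 2 * α' + β * α' + α * α' ^ 2 - β * α' ^ 2 - α * β'
        + α ^ 2 * β') * X 3) * (X 0 * X 2)
  + (C (α ^ 2 * α' - α * β * α' - α * α' ^ 2 + α * β * α' ^ 2 + α * α' * β'
      - α ^ 2 * α' * β') * X 3) * X 0 ^ 2

end Polynomials

/-- Two skew lines `b₅, b₆` and five pairwise skew lines `a₁, a₂, a₃, a₄, c₅₆`, each of which
meets both `b₅` and `b₆`. The lines `a₁, …, a₄` are `a 0, …, a 3`. -/
structure SevenLines where
  b₅ : Submodule ℂ (Fin 4 → ℂ)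
  b₆ : Submodule ℂ (Fin 4 → ℂ)
  c₅₆ : Submodule ℂ (Fin 4 → ℂ)
  a : Fin 4 → Submodule ℂ (Fin 4 → ℂ)
  isProjLine_b₅ : IsProjLine b₅
  isProjLine_b₆ : IsProjLine b₆
  isProjLine_c₅₆ : IsProjLine c₅₆
  isProjLine_a : ∀ i, IsProjLine (a i)
  skew_b : SkewLines b₅ b₆
  skew_a : ∀ i j, i ≠ j → SkewLines (a i) (a j)
  skew_a_c₅₆ : ∀ i, SkewLines (a i) c₅₆
  meet_a_b₅ : ∀ i, LinesMeet (a i) b₅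
  meet_a_b₆ : ∀ i, LinesMeet (a i) b₆
  meet_c₅₆_b₅ : LinesMeet c₅₆ b₅
  meet_c₅₆_b₆ : LinesMeet c₅₆ b₆

namespace SevenLines

/-- `α = (c₅₆, a₁; a₂, a₃)` on `b₅`. -/
def alpha (L : SevenLines) : ℂ := crossRatio L.b₅ L.c₅₆ (L.a 0) (L.a 1) (L.a 2)

/-- `α' = (c₅₆, a₁; a₂, a₃)` on `b₆`. -/
def alpha' (L : SevenLines) : ℂ := crossRatio L.b₆ L.c₅₆ (L.a 0) (L.a 1) (L.a 2)

/-- `β = (c₅₆, a₁; a₂, a₄)` on `b₅`. -/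
def beta (L : SevenLines) : ℂ := crossRatio L.b₅ L.c₅₆ (L.a 0) (L.a 1) (L.a 3)

/-- `β' = (c₅₆, a₁; a₂, a₄)` on `b₆`. -/
def beta' (L : SevenLines) : ℂ := crossRatio L.b₆ L.c₅₆ (L.a 0) (L.a 1) (L.a 3)

/-- All seven lines are contained in the surface `F = 0`. -/
def LieOn (L : SevenLines) (F : MvPolynomial (Fin 4) ℂ) : Prop :=
  ContainsLine F L.b₅ ∧ ContainsLine F L.b₆ ∧ ContainsLine F L.c₅₆ ∧
    ∀ i, ContainsLine F (L.a i)

/-- The homogeneous coordinates `(z₁, z₂, z₃, z₄) = e x` are adapted to the configuration: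
`b₅` is `z₁ = z₃ = 0`, `b₆` is `z₂ = z₄ = 0`, the lines `a₁, a₂, c₅₆` meet `b₅` in the points
`z₂ / z₄ = 0, 1, ∞` and they meet `b₆` in the points `z₁ / z₃ = 0, 1, ∞`. -/
structure IsAdapted (L : SevenLines) (e : (Fin 4 → ℂ) ≃ₗ[ℂ] (Fin 4 → ℂ)) : Prop where
  b₅_eq : ∀ x, x ∈ L.b₅ ↔ e x 0 = 0 ∧ e x 2 = 0
  b₆_eq : ∀ x, x ∈ L.b₆ ↔ e x 1 = 0 ∧ e x 3 = 0
  a₁_b₅ : ∀ x ∈ L.a 0 ⊓ L.b₅, e x 1 = 0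
  a₂_b₅ : ∀ x ∈ L.a 1 ⊓ L.b₅, e x 1 = e x 3
  c₅₆_b₅ : ∀ x ∈ L.c₅₆ ⊓ L.b₅, e x 3 = 0
  a₁_b₆ : ∀ x ∈ L.a 0 ⊓ L.b₆, e x 0 = 0
  a₂_b₆ : ∀ x ∈ L.a 1 ⊓ L.b₆, e x 0 = e x 2
  c₅₆_b₆ : ∀ x ∈ L.c₅₆ ⊓ L.b₆, e x 2 = 0

/-- The cubic `C₁` of the configuration in the coordinates `z = e x`. -/
def cubicOne (L : SevenLines) (e : (Fin 4 → ℂ) ≃ₗ[ℂ] (Fin 4 → ℂ)) :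
    MvPolynomial (Fin 4) ℂ :=
  pullbackForm e (explicitCubicOne L.alpha'⁻¹ L.beta'⁻¹ L.alpha⁻¹ L.beta⁻¹)

/-- The cubic `C₂` of the configuration in the coordinates `z = e x`. -/
def cubicTwo (L : SevenLines) (e : (Fin 4 → ℂ) ≃ₗ[ℂ] (Fin 4 → ℂ)) :
    MvPolynomial (Fin 4) ℂ :=
  pullbackForm e (explicitCubicTwo L.alpha'⁻¹ L.beta'⁻¹ L.alpha⁻¹ L.beta⁻¹)

/-- The linear system spanned by `C₁` and `C₂`. -/
def pencil (L : SevenLines) (e : (Fin 4 → ℂ) ≃ₗ[ℂ] (Fin 4 → ℂ)) :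
    Submodule ℂ (MvPolynomial (Fin 4) ℂ) :=
  Submodule.span ℂ {L.cubicOne e, L.cubicTwo e}

end SevenLines

end

/-!
A cubic form `F` is written as `F(x) = φ(x, x, x)` with a symmetric trilinear form `φ`. The
differential of `F` at `x` is `3 φ(x, x, ·)`, so that the surface is non-singular iff
`φ(x, x, ·) ≠ 0` for all `x ≠ 0`.

**The explicit cubics.** In adapted coordinates a cubic through `b₅` and `b₆` is the sum of a form
of bidegree `(1, 2)` and one of bidegree `(2, 1)` in `(z₁, z₃)` and `(z₂, z₄)`. Each transversal is
a point of `ℙ¹ × ℙ¹` at which both forms have to vanish. The points `(0, 0)` and `(∞, ∞)` remove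
two of the six monomials of each form, and `(1, 1)`, `(α', α)`, `(β', β)` give three linear
conditions on the remaining four coefficients. The coefficients of the two explicit cubics are the
maximal minors of these conditions, and so span the solutions unless the minors all vanish
(`exists_eq_mul_coeff_one`, `exists_eq_mul_coeff_two`). They vanish only if `α = α'` and `β = β'`
(`eq_of_coeff_eq_zero`); then the lines lie on a quadric that is a component of every cubic
containing them, and no such cubic is non-singular (`SevenLines.IsAdapted.not_cross_ratios_eq`).
Scaling `z₁` and `z₃` moves the members of the pencil other than the two explicit cubics, which are
singular, into each other (`SevenLines.projectivelyIsomorphic_of_mem_pencil`).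

**The seven lines on a non-singular cubic.** Given a line on the surface, the planes through it cut
out residual conics, whose discriminant is a form of degree `5` on the pencil of planes. Its roots
are simple (`exists_residualDisc_polynomial`): at a root, its derivative in the direction `z` is a
non-zero multiple of `φ(p, p, z)`, where `p` is the singular point of the conic
(`det_derivative_ne_zero`), and as `φ(p, p, ·)` vanishes on the plane this is not zero. So there are
five planes with a degenerate conic. Lines in different ones of these planes are skew
(`skewLines_of_plane_ne`). Two of them serve as `b₅` and `b₆`; each of the five planes of `b₅`
meets `b₆` in a point, and contains a line through this point, which meets `b₅` as well.

**Existence of a line.** The Fermat cubic contains a line. In the pencil that joins it to the given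
cubic only finitely many members are singular (`IsNonsingularForm.finite_singular`, a consequence of
the Nullstellensatz). The parameters of the members that contain a line form a closed set by
compactness, and this set is a neighbourhood of each of its points that belongs to a non-singular
member, by the implicit function theorem: a line on a non-singular cubic surface has no
infinitesimal deformations (`IsNonsingularForm.deformation_eq_zero`). As the complement of a finite
set in `ℂ` is connected, the given cubic contains a line.
-/

/-! ### Cubic forms and symmetric trilinear forms -/

/-- A symmetric trilinear form. -/
structure IsSymmTrilinear (φ : (Fin 4 → ℂ) →ₗ[ℂ] (Fin 4 → ℂ) →ₗ[ℂ] (Fin 4 → ℂ) →ₗ[ℂ] ℂ) :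
    Prop where
  swap₁₂ : ∀ x y z, φ x y z = φ y x z
  swap₂₃ : ∀ x y z, φ x y z = φ x z y

/-- The cubic surface `φ(x, x, x) = 0` is non-singular. Up to the factor `3`, the linear form
`φ(x, x, ·)` is the differential of the cubic form at `x`; if it vanishes, then so does
`φ(x, x, x)`, so that the vanishing of the cubic form itself need not be mentioned. -/
def IsNonsingularForm (φ : (Fin 4 → ℂ) →ₗ[ℂ] (Fin 4 → ℂ) →ₗ[ℂ] (Fin 4 → ℂ) →ₗ[ℂ] ℂ) : Prop :=
  ∀ x, x ≠ 0 → ∃ v, φ x x v ≠ 0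

/-- The projective line `l` lies on the cubic surface `φ(x, x, x) = 0`. -/
def IsLineOn (φ : (Fin 4 → ℂ) →ₗ[ℂ] (Fin 4 → ℂ) →ₗ[ℂ] (Fin 4 → ℂ) →ₗ[ℂ] ℂ)
    (l : Submodule ℂ (Fin 4 → ℂ)) : Prop :=
  IsProjLine l ∧ ∀ x ∈ l, φ x x x = 0

/-- The trilinear form `x p * y q * z r`. -/
def coordTrilinear (p q r : Fin 4) :
    (Fin 4 → ℂ) →ₗ[ℂ] (Fin 4 → ℂ) →ₗ[ℂ] (Fin 4 → ℂ) →ₗ[ℂ] ℂ :=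
  LinearMap.smulRight (LinearMap.proj p)
    (LinearMap.smulRight (LinearMap.proj q) (LinearMap.proj r))

theorem coordTrilinear_apply (p q r : Fin 4) (x y z : Fin 4 → ℂ) :
    coordTrilinear p q r x y z = x p * y q * z r := by
  simp [coordTrilinear, mul_assoc]

/-- Every form of degree `3` is `φ(x, x, x)` for a symmetric trilinear form `φ`, and its
differential at `x` is `3 φ(x, x, ·)`. -/
theorem MvPolynomial.IsHomogeneous.exists_trilinear {F : MvPolynomial (Fin 4) ℂ}
    (hF : F.IsHomogeneous 3) :
    ∃ φ, IsSymmTrilinear φ ∧ (∀ x, MvPolynomial.eval x F = φ x x x) ∧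
      ∀ x v, ∑ i, v i * MvPolynomial.eval x (MvPolynomial.pderiv i F) = 3 * φ x x v := by
  classical
  have key : ∀ s : Finset (Fin 4 →₀ ℕ), (∀ d ∈ s, d.degree = 3) →
      ∃ φ, IsSymmTrilinear φ ∧
      (∀ x, MvPolynomial.eval x (∑ d ∈ s, MvPolynomial.monomial d (F.coeff d)) = φ x x x) ∧
      ∀ x v, ∑ i, v i * MvPolynomial.eval x (MvPolynomial.pderiv i
        (∑ d ∈ s, MvPolynomial.monomial d (F.coeff d))) = 3 * φ x x v := by
    intro s
    induction s using Finset.induction_on with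
    | empty =>
      intro _
      exact ⟨0, ⟨by simp, by simp⟩, by simp, by simp⟩
    | insert d s hd ih =>
      intro hs
      obtain ⟨φ, hφ, h1, h2⟩ := ih fun d' hd' => hs d' (Finset.mem_insert_of_mem hd')
      -- a monomial of degree `3` is a product of three variables
      obtain ⟨p, q, r, hpqr⟩ : ∃ p q r, d = Finsupp.single p 1 + Finsupp.single q 1 +
          Finsupp.single r 1 := by
        have h3 : d.toMultiset.card = 3 := by
          rw [Finsupp.card_toMultiset, ← hs d (Finset.mem_insert_self _ _)]
          rfl
        obtain ⟨p, q, r, h⟩ := Multiset.card_eq_three.1 h3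
        refine ⟨p, q, r, ?_⟩
        rw [← Finsupp.toMultiset_toFinsupp d, h]
        rw [show ({p, q, r} : Multiset (Fin 4)) = {p} + {q} + {r} from rfl]
        simp only [map_add, Multiset.toFinsupp_singleton]
      have hm : MvPolynomial.monomial d (F.coeff d) = MvPolynomial.C (F.coeff d) *
          (MvPolynomial.X p * MvPolynomial.X q * MvPolynomial.X r) := by
        simp only [MvPolynomial.X, MvPolynomial.monomial_mul, MvPolynomial.C_mul_monomial, hpqr]
        simp
      let ψ := (F.coeff d / 6) • (coordTrilinear p q r + coordTrilinear p r q
        + coordTrilinear q p r + coordTrilinear q r p + coordTrilinear r p q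
        + coordTrilinear r q p)
      have hψ : ∀ x y z, ψ x y z = F.coeff d / 6 *
          (x p * y q * z r + x p * y r * z q + x q * y p * z r
            + x q * y r * z p + x r * y p * z q + x r * y q * z p) := by
        intro x y z
        simp only [ψ, LinearMap.smul_apply, LinearMap.add_apply, coordTrilinear_apply,
          smul_eq_mul]
      refine ⟨φ + ψ, ⟨fun x y z => ?_, fun x y z => ?_⟩, fun x => ?_, fun x v => ?_⟩
      · simp only [LinearMap.add_apply, hφ.swap₁₂ x y z, hψ]; ring
      · simp only [LinearMap.add_apply, hφ.swap₂₃ x y z, hψ]; ring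
      · rw [Finset.sum_insert hd, map_add, h1, hm]
        simp only [LinearMap.add_apply, hψ, map_mul, MvPolynomial.eval_C, MvPolynomial.eval_X]
        ring
      · let δ : Fin 4 → Fin 4 → ℂ := fun i j => if i = j then 1 else 0
        have hX : ∀ i j, MvPolynomial.eval x (MvPolynomial.pderiv i (MvPolynomial.X j)) =
            δ i j := by
          intro i j
          rw [MvPolynomial.pderiv_X, Pi.single_apply]
          simp only [δ, eq_comm (a := i)]
          split_ifs <;> simp
        have hC : ∀ i, MvPolynomial.eval x (MvPolynomial.pderiv i (MvPolynomial.C (F.coeff d) *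
            (MvPolynomial.X p * MvPolynomial.X q * MvPolynomial.X r))) =
            F.coeff d * (δ i p * x q * x r + x p * δ i q * x r + x p * x q * δ i r) := by
          intro i
          simp only [Derivation.leibniz, MvPolynomial.pderiv_C, smul_eq_mul, map_add, map_mul,
            MvPolynomial.eval_C, MvPolynomial.eval_X, hX, map_zero]
          ring
        have h' : ∀ a, ∑ i, v i * δ i a = v a := by intro a; simp [δ]
        simp only [Finset.sum_insert hd, map_add, mul_add, Finset.sum_add_distrib, h2, hm,
          LinearMap.add_apply, hψ, hC]
        have h3 : ∀ i, v i * (F.coeff d * (δ i p * x q * x r)) + v i * (F.coeff d *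
            (x p * δ i q * x r)) + v i * (F.coeff d * (x p * x q * δ i r)) = 
            F.coeff d * x q * x r * (v i * δ i p) + F.coeff d * x p * x r * (v i * δ i q)
            + F.coeff d * x p * x q * (v i * δ i r) := by intro i; ring
        simp only [← Finset.sum_add_distrib, h3]
        simp only [Finset.sum_add_distrib, ← Finset.mul_sum, h']
        ring
  have h := key F.support fun d hd => by
    have := hF (MvPolynomial.mem_support_iff.1 hd)
    rw [Finsupp.degree_eq_weight_one (R := ℕ)]
    exact this
  rwa [MvPolynomial.support_sum_monomial_coeff] at h

/-- The form of a non-singular cubic is non-singular. -/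
theorem IsNonsingularCubic.isNonsingularForm {F : MvPolynomial (Fin 4) ℂ}
    {φ : (Fin 4 → ℂ) →ₗ[ℂ] (Fin 4 → ℂ) →ₗ[ℂ] (Fin 4 → ℂ) →ₗ[ℂ] ℂ}
    (hF : IsNonsingularCubic F) (h : ∀ x, MvPolynomial.eval x F = φ x x x)
    (h' : ∀ x v, ∑ i, v i * MvPolynomial.eval x (MvPolynomial.pderiv i F) = 3 * φ x x v) :
    IsNonsingularForm φ := by
  intro x hx
  by_contra! hv
  obtain ⟨i, hi⟩ := hF.2 x hx (by rw [h, hv])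
  have := h' x (Pi.single i 1)
  rw [hv, mul_zero] at this
  simp [Pi.single_apply] at this
  exact hi this

namespace IsSymmTrilinear

variable {φ : (Fin 4 → ℂ) →ₗ[ℂ] (Fin 4 → ℂ) →ₗ[ℂ] (Fin 4 → ℂ) →ₗ[ℂ] ℂ}

theorem apply_combo (h : IsSymmTrilinear φ) (a b : ℂ) (u v z : Fin 4 → ℂ) :
    φ (a • u + b • v) (a • u + b • v) z =
      a ^ 2 * φ u u z + 2 * a * b * φ u v z + b ^ 2 * φ v v z := by
  simp only [map_add, map_smul, LinearMap.add_apply, LinearMap.smul_apply, smul_eq_mul,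
    h.swap₁₂ v u]
  ring

theorem cube_combo (h : IsSymmTrilinear φ) (a b : ℂ) (u v : Fin 4 → ℂ) :
    φ (a • u + b • v) (a • u + b • v) (a • u + b • v) =
      a ^ 3 * φ u u u + 3 * a ^ 2 * b * φ u u v + 3 * a * b ^ 2 * φ u v v
        + b ^ 3 * φ v v v := by
  rw [h.apply_combo]
  simp only [map_add, map_smul, smul_eq_mul, h.swap₂₃ u v u, h.swap₁₂ v u v, h.swap₂₃ v v u]
  ring

/-- The values `φ(x, x, v)` are determined by the cubic form. -/
theorem six_mul_apply (h : IsSymmTrilinear φ) (x v : Fin 4 → ℂ) :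
    6 * φ x x v = φ (v + x) (v + x) (v + x) + φ (v - x) (v - x) (v - x) - 2 * φ v v v := by
  have h1 := h.cube_combo 1 1 v x
  have h2 := h.cube_combo 1 (-1) v x
  simp only [one_smul, neg_smul, ← sub_eq_add_neg] at h1 h2
  rw [h1, h2, h.swap₁₂ v x x, h.swap₂₃ x v x]
  ring

/-- A cubic form vanishes on the span of two vectors iff its four coefficients there vanish. -/
theorem cube_combo_eq_zero_iff (h : IsSymmTrilinear φ) (u v : Fin 4 → ℂ) :
    (∀ a b : ℂ, φ (a • u + b • v) (a • u + b • v) (a • u + b • v) = 0) ↔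
      φ u u u = 0 ∧ φ u u v = 0 ∧ φ u v v = 0 ∧ φ v v v = 0 := by
  constructor
  · intro H
    have h1 := H 1 0
    have h2 := H 0 1
    have h3 := H 1 1
    have h4 := H 1 (-1)
    rw [h.cube_combo] at h1 h2 h3 h4
    refine ⟨?_, ?_, ?_, ?_⟩
    · linear_combination h1
    · linear_combination (1 / 6) * h3 - (1 / 6) * h4 - (1 / 3) * h2
    · linear_combination (1 / 6) * h3 + (1 / 6) * h4 - (1 / 3) * h1
    · linear_combination h2
  · rintro ⟨h1, h2, h3, h4⟩ a b
    rw [h.cube_combo, h1, h2, h3, h4]; ring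

theorem apply_eq_zero_of_mem (h : IsSymmTrilinear φ) {l : Submodule ℂ (Fin 4 → ℂ)}
    (hl : ∀ x ∈ l, φ x x x = 0) {x y : Fin 4 → ℂ} (hx : x ∈ l) (hy : y ∈ l) :
    φ x x y = 0 :=
  ((h.cube_combo_eq_zero_iff x y).1 fun a b =>
    hl _ (l.add_mem (l.smul_mem a hx) (l.smul_mem b hy))).2.1

end IsSymmTrilinear

theorem isLineOn_span_pair
    {φ : (Fin 4 → ℂ) →ₗ[ℂ] (Fin 4 → ℂ) →ₗ[ℂ] (Fin 4 → ℂ) →ₗ[ℂ] ℂ} {u v : Fin 4 → ℂ}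
    (huv : LinearIndependent ℂ ![u, v])
    (H : ∀ a b : ℂ, φ (a • u + b • v) (a • u + b • v) (a • u + b • v) = 0) :
    IsLineOn φ (Submodule.span ℂ {u, v}) := by
  constructor
  · have := finrank_span_eq_card huv
    rwa [Matrix.range_cons_cons_empty, Fintype.card_fin] at this
  · intro x hx
    obtain ⟨a, b, rfl⟩ := Submodule.mem_span_pair.1 hx
    exact H a b

/-- Two lines on a non-singular cubic surface that lie in different planes through a line `l` on the
surface are skew, unless one of them is `l`. Indeed, a common point would lie on `l`, and the
tangent plane there would contain both planes. -/
theorem skewLines_of_plane_ne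
    {φ : (Fin 4 → ℂ) →ₗ[ℂ] (Fin 4 → ℂ) →ₗ[ℂ] (Fin 4 → ℂ) →ₗ[ℂ] ℂ}
    (h : IsSymmTrilinear φ) (hns : IsNonsingularForm φ)
    {l m m' P P' : Submodule ℂ (Fin 4 → ℂ)} (hl : IsLineOn φ l) (hm : IsLineOn φ m)
    (hm' : IsLineOn φ m') (hP : Module.finrank ℂ P = 3) (hP' : Module.finrank ℂ P' = 3)
    (hne : P ≠ P') (hlP : l ≤ P) (hlP' : l ≤ P') (hmP : m ≤ P) (hmP' : m' ≤ P')
    (hml : m ≠ l) (hml' : m' ≠ l) : SkewLines m m' := by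
  have hl2 : Module.finrank ℂ l = 2 := hl.1
  -- a plane through `l` is spanned by `l` and any other line in it
  have hsup : ∀ {n Q : Submodule ℂ (Fin 4 → ℂ)}, IsLineOn φ n → Module.finrank ℂ Q = 3 →
      l ≤ Q → n ≤ Q → n ≠ l → l ⊔ n = Q := by
    intro n Q hn hQ hlQ hnQ hnl
    refine Submodule.eq_of_le_of_finrank_le (sup_le hlQ hnQ) ?_
    have hlt : l < l ⊔ n := by
      refine lt_of_le_of_ne le_sup_left fun he => hnl ?_
      exact Submodule.eq_of_le_of_finrank_eq (by rw [he]; exact le_sup_right)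
        (hn.1.trans hl.1.symm)
    have := Submodule.finrank_lt_finrank_of_lt hlt
    omega
  have hPP : P ⊔ P' = ⊤ := by
    refine Submodule.eq_top_of_finrank_eq (le_antisymm (Submodule.finrank_le _) ?_)
    have hlt : P < P ⊔ P' := by
      refine lt_of_le_of_ne le_sup_left fun he => hne ?_
      exact (Submodule.eq_of_le_of_finrank_eq (by rw [he]; exact le_sup_right)
        (hP'.trans hP.symm)).symm
    have := Submodule.finrank_lt_finrank_of_lt hlt
    simp only [Module.finrank_fin_fun]
    omega
  have hinf : P ⊓ P' = l := by
    refine (Submodule.eq_of_le_of_finrank_le (le_inf hlP hlP') ?_).symm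
    have := Submodule.finrank_sup_add_finrank_inf_eq P P'
    rw [hPP, finrank_top, Module.finrank_fin_fun] at this
    omega
  rw [SkewLines, Submodule.eq_bot_iff]
  rintro x ⟨hx, hx'⟩
  by_contra hx0
  have hxl : x ∈ l := hinf ▸ Submodule.mem_inf.2 ⟨hmP hx, hmP' hx'⟩
  obtain ⟨v, hv⟩ := hns x hx0
  have hle : P ⊔ P' ≤ LinearMap.ker (φ x x) := by
    rw [← hsup hm hP hlP hmP hml, ← hsup hm' hP' hlP' hmP' hml']
    refine sup_le (sup_le ?_ ?_) (sup_le ?_ ?_) <;> intro y hy <;> rw [LinearMap.mem_ker]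
    exacts [h.apply_eq_zero_of_mem hl.2 hxl hy, h.apply_eq_zero_of_mem hm.2 hx hy,
      h.apply_eq_zero_of_mem hl.2 hxl hy, h.apply_eq_zero_of_mem hm'.2 hx' hy]
  rw [hPP] at hle
  exact hv (LinearMap.mem_ker.1 (hle Submodule.mem_top))

/-! ### Singular symmetric matrices -/

theorem exists_binary_quadratic_zero (α β γ : ℂ) :
    ∃ a b : ℂ, (a ≠ 0 ∨ b ≠ 0) ∧ α * a ^ 2 + 2 * β * a * b + γ * b ^ 2 = 0 := by
  by_cases hα : α = 0
  · exact ⟨1, 0, by simp, by rw [hα]; ring⟩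
  · obtain ⟨s, hs⟩ := IsAlgClosed.exists_pow_nat_eq (β ^ 2 - α * γ) (n := 2) (by norm_num)
    exact ⟨-β + s, α, Or.inr hα, by linear_combination α * hs⟩

/-- Let `M` be a singular symmetric `3 × 3` matrix, with the entries `A, B, C, D, E, G`, and `N` a
symmetric matrix whose quadratic form has no non-trivial zero on the kernel of `M`. Then the
derivative of the determinant at `M` in the direction `N` is not zero. Indeed the kernel is then
one-dimensional, as a quadratic form in two variables has a zero, and so the adjugate matrix of
`M` is a non-zero multiple of `v vᵀ`, with `v` in the kernel. -/
theorem det_derivative_ne_zero {A B C D E G A' B' C' D' E' G' : ℂ}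
    (hdet : A * C * G + 2 * B * D * E - A * E ^ 2 - B ^ 2 * G - C * D ^ 2 = 0)
    (h : ∀ x y t : ℂ, (x ≠ 0 ∨ y ≠ 0 ∨ t ≠ 0) → A * x + B * y + D * t = 0 →
      B * x + C * y + E * t = 0 → D * x + E * y + G * t = 0 →
      A' * x ^ 2 + 2 * B' * x * y + C' * y ^ 2 + 2 * D' * x * t + 2 * E' * y * t
        + G' * t ^ 2 ≠ 0) :
    A' * (C * G - E ^ 2) + 2 * B' * (D * E - B * G) + C' * (A * G - D ^ 2)
      + 2 * D' * (B * E - C * D) + 2 * E' * (B * D - A * E) + G' * (A * C - B ^ 2) ≠ 0 := by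
  -- two independent vectors in the kernel
  have two : ∀ x₁ y₁ t₁ x₂ y₂ t₂ : ℂ,
      A * x₁ + B * y₁ + D * t₁ = 0 → B * x₁ + C * y₁ + E * t₁ = 0 →
      D * x₁ + E * y₁ + G * t₁ = 0 →
      A * x₂ + B * y₂ + D * t₂ = 0 → B * x₂ + C * y₂ + E * t₂ = 0 →
      D * x₂ + E * y₂ + G * t₂ = 0 →
      (∀ a b : ℂ, a * x₁ + b * x₂ = 0 → a * y₁ + b * y₂ = 0 → a * t₁ + b * t₂ = 0 →
        a = 0 ∧ b = 0) → False := by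
    intro x₁ y₁ t₁ x₂ y₂ t₂ h1 h2 h3 k1 k2 k3 hi
    obtain ⟨a, b, hab, hz⟩ := exists_binary_quadratic_zero
      (A' * x₁ ^ 2 + 2 * B' * x₁ * y₁ + C' * y₁ ^ 2 + 2 * D' * x₁ * t₁ + 2 * E' * y₁ * t₁
        + G' * t₁ ^ 2)
      (A' * x₁ * x₂ + B' * (x₁ * y₂ + x₂ * y₁) + C' * y₁ * y₂ + D' * (x₁ * t₂ + x₂ * t₁)
        + E' * (y₁ * t₂ + y₂ * t₁) + G' * t₁ * t₂)
      (A' * x₂ ^ 2 + 2 * B' * x₂ * y₂ + C' * y₂ ^ 2 + 2 * D' * x₂ * t₂ + 2 * E' * y₂ * t₂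
        + G' * t₂ ^ 2)
    refine h (a * x₁ + b * x₂) (a * y₁ + b * y₂) (a * t₁ + b * t₂) ?_
      (by linear_combination a * h1 + b * k1) (by linear_combination a * h2 + b * k2)
      (by linear_combination a * h3 + b * k3) (by linear_combination hz)
    by_contra! hc
    have := hi a b hc.1 hc.2.1 hc.2.2
    tauto
  intro hS
  -- the rows of the adjugate matrix
  have r1 := h (C * G - E ^ 2) (D * E - B * G) (B * E - C * D)
  have r2 := h (D * E - B * G) (A * G - D ^ 2) (B * D - A * E)
  have r3 := h (B * E - C * D) (B * D - A * E) (A * C - B ^ 2)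
  have z1 : C * G - E ^ 2 = 0 ∧ D * E - B * G = 0 ∧ B * E - C * D = 0 := by
    by_contra hc
    refine r1 (by tauto) (by linear_combination hdet) (by ring) (by ring) ?_
    linear_combination (C * G - E ^ 2) * hS + (-C' * G + 2 * E' * E - G' * C) * hdet
  have z2 : D * E - B * G = 0 ∧ A * G - D ^ 2 = 0 ∧ B * D - A * E = 0 := by
    by_contra hc
    refine r2 (by tauto) (by ring) (by linear_combination hdet) (by ring) ?_
    linear_combination (A * G - D ^ 2) * hS + (-A' * G + 2 * D' * D - G' * A) * hdet
  have z3 : B * E - C * D = 0 ∧ B * D - A * E = 0 ∧ A * C - B ^ 2 = 0 := by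
    by_contra hc
    refine r3 (by tauto) (by ring) (by ring) (by linear_combination hdet) ?_
    linear_combination (A * C - B ^ 2) * hS + (-A' * C + 2 * B' * B - C' * A) * hdet
  by_cases hA : A = 0
  · have hB : B = 0 := by
      have := z3.2.2
      rw [hA] at this
      simpa using this
    have hD : D = 0 := by
      have := z2.2.1
      rw [hA] at this
      simpa using this
    subst hA hB hD
    by_cases hC : C = 0
    · have hE : E = 0 := by
        have := z1.1
        rw [hC] at this
        simpa using this
      subst hC hE
      exact two 1 0 0 0 1 0 (by ring) (by ring) (by ring) (by ring) (by ring) (by ring)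
        fun a b h1 h2 _ => ⟨by simpa using h1, by simpa using h2⟩
    · refine two 1 0 0 0 E (-C) (by ring) (by ring) (by ring) (by ring) (by ring)
        (by linear_combination -z1.1) fun a b h1 _ h3 => ⟨by simpa using h1, ?_⟩
      have : b = 0 ∨ C = 0 := by simpa using h3
      tauto
  · refine two B (-A) 0 D 0 (-A) (by ring) (by linear_combination -z3.2.2)
      (by linear_combination z3.2.1) (by ring) (by linear_combination z2.2.2)
      (by linear_combination -z2.2.1) fun a b h1 h2 h3 => ⟨?_, ?_⟩
    · have : a = 0 ∨ A = 0 := by simpa using h2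
      tauto
    · have : b = 0 ∨ A = 0 := by simpa using h3
      tauto

/-! ### The residual conics in the planes through a line -/

theorem linearIndependent_four_iff {u v w z : Fin 4 → ℂ} :
    LinearIndependent ℂ ![u, v, w, z] ↔ ∀ a b c d : ℂ,
      a • u + b • v + c • w + d • z = 0 → a = 0 ∧ b = 0 ∧ c = 0 ∧ d = 0 := by
  rw [Fintype.linearIndependent_iff]
  constructor
  · intro h a b c d habcd
    have := h ![a, b, c, d] (by simpa [Fin.sum_univ_four] using habcd)
    exact ⟨this 0, this 1, this 2, this 3⟩
  · intro h g hg
    rw [Fin.sum_univ_four] at hg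
    obtain ⟨h0, h1, h2, h3⟩ := h _ _ _ _ hg
    intro i
    fin_cases i
    exacts [h0, h1, h2, h3]

theorem LinearIndependent.exists_combo_four {u v w z : Fin 4 → ℂ}
    (h : LinearIndependent ℂ ![u, v, w, z]) (x : Fin 4 → ℂ) :
    ∃ a b c d : ℂ, x = a • u + b • v + c • w + d • z := by
  have hs := h.span_eq_top_of_card_eq_finrank' (by simp)
  have hx : x ∈ Submodule.span ℂ (Set.range ![u, v, w, z]) := hs ▸ Submodule.mem_top
  obtain ⟨c, hc⟩ := (Submodule.mem_span_range_iff_exists_fun ℂ).1 hx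
  refine ⟨c 0, c 1, c 2, c 3, ?_⟩
  rw [← hc, Fin.sum_univ_four]
  rfl

theorem IsProjLine.exists_span_pair {l : Submodule ℂ (Fin 4 → ℂ)} (hl : IsProjLine l) :
    ∃ u v, LinearIndependent ℂ ![u, v] ∧ l = Submodule.span ℂ {u, v} := by
  let b := Module.finBasisOfFinrankEq ℂ l hl
  have hb : (fun i => (b i : Fin 4 → ℂ)) = ![(b 0 : Fin 4 → ℂ), b 1] := by
    funext i
    fin_cases i <;> rfl
  have hi : LinearIndependent ℂ ![(b 0 : Fin 4 → ℂ), b 1] := by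
    rw [← hb]
    exact b.linearIndependent.map' l.subtype (Submodule.ker_subtype l)
  refine ⟨b 0, b 1, hi, (Submodule.eq_of_le_of_finrank_eq ?_ ?_).symm⟩
  · rw [Submodule.span_le]
    rintro x (rfl | rfl) <;> exact Subtype.property _
  · have := finrank_span_eq_card hi
    rw [Matrix.range_cons_cons_empty, Fintype.card_fin] at this
    exact this.trans hl.symm

/-- A line is spanned by the first two vectors of a basis of the whole space. -/
theorem IsProjLine.exists_frame {l : Submodule ℂ (Fin 4 → ℂ)} (hl : IsProjLine l) :
    ∃ u v w z, LinearIndependent ℂ ![u, v, w, z] ∧ l = Submodule.span ℂ {u, v} := by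
  obtain ⟨q, hq⟩ := Submodule.exists_isCompl l
  have hq2 : IsProjLine q := by
    have := Submodule.finrank_add_eq_of_isCompl hq
    rw [Module.finrank_fin_fun] at this
    unfold IsProjLine at hl ⊢
    omega
  obtain ⟨u, v, huv, rfl⟩ := hl.exists_span_pair
  obtain ⟨w, z, hwz, rfl⟩ := hq2.exists_span_pair
  refine ⟨u, v, w, z, linearIndependent_four_iff.2 fun a b c d h => ?_, rfl⟩
  have h0 : a • u + b • v = 0 := by
    have h1 : a • u + b • v ∈ Submodule.span ℂ {w, z} :=
      Submodule.mem_span_pair.2 ⟨-c, -d, by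
        rw [← sub_eq_zero, ← neg_eq_zero, ← h]; module⟩
    exact (Submodule.disjoint_def.1 hq.disjoint) _ (Submodule.mem_span_pair.2 ⟨a, b, rfl⟩) h1
  rw [h0, zero_add] at h
  have h2 := LinearIndependent.pair_iff.1 huv a b h0
  have h3 := LinearIndependent.pair_iff.1 hwz c d h
  exact ⟨h2.1, h2.2, h3.1, h3.2⟩

/-- The cubic surface of `φ` contains the line spanned by `u` and `v`. The plane spanned by `u`,
`v`, `w` cuts out this line and a residual conic, whose equation in the coordinates of
`x u + y v + t w` is `A x² + 2 B x y + C y² + 2 D x t + 2 E y t + G t² = 0` with `A = φ(u, u, w)`,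
`B = φ(u, v, w)`, `C = φ(v, v, w)`, `D = φ(u, w, w) / 2`, `E = φ(v, w, w) / 2`,
`G = φ(w, w, w) / 3`; this is the discriminant of the conic. -/
noncomputable def residualDisc (φ : (Fin 4 → ℂ) →ₗ[ℂ] (Fin 4 → ℂ) →ₗ[ℂ] (Fin 4 → ℂ) →ₗ[ℂ] ℂ)
    (u v w : Fin 4 → ℂ) : ℂ :=
  φ u u w * φ v v w * (φ w w w / 3) + 2 * φ u v w * (φ u w w / 2) * (φ v w w / 2)
    - φ u u w * (φ v w w / 2) ^ 2 - φ u v w ^ 2 * (φ w w w / 3)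
    - φ v v w * (φ u w w / 2) ^ 2

namespace IsSymmTrilinear

variable {φ : (Fin 4 → ℂ) →ₗ[ℂ] (Fin 4 → ℂ) →ₗ[ℂ] (Fin 4 → ℂ) →ₗ[ℂ] ℂ}

theorem apply_combo_three (h : IsSymmTrilinear φ) (x y t : ℂ) (u v w z : Fin 4 → ℂ) :
    φ (x • u + y • v + t • w) (x • u + y • v + t • w) z =
      φ u u z * x ^ 2 + 2 * φ u v z * x * y + φ v v z * y ^ 2 + 2 * φ u w z * x * t
        + 2 * φ v w z * y * t + φ w w z * t ^ 2 := by
  simp only [map_add, map_smul, LinearMap.add_apply, LinearMap.smul_apply, smul_eq_mul,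
    h.swap₁₂ v u, h.swap₁₂ w u, h.swap₁₂ w v]
  ring

/-- The section of a cubic surface by a plane through a line on the surface. -/
theorem cube_combo_three (h : IsSymmTrilinear φ) {u v : Fin 4 → ℂ}
    (huuu : φ u u u = 0) (huuv : φ u u v = 0) (huvv : φ u v v = 0) (hvvv : φ v v v = 0)
    (x y t : ℂ) (w : Fin 4 → ℂ) :
    φ (x • u + y • v + t • w) (x • u + y • v + t • w) (x • u + y • v + t • w) =
      3 * t * (φ u u w * x ^ 2 + 2 * φ u v w * x * y + φ v v w * y ^ 2
        + 2 * (φ u w w / 2) * x * t + 2 * (φ v w w / 2) * y * t + (φ w w w / 3) * t ^ 2) := by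
  rw [h.apply_combo_three]
  simp only [map_add, map_smul, smul_eq_mul, huuu, huuv, huvv, hvvv, h.swap₂₃ u v u,
    h.swap₂₃ u w u, h.swap₂₃ u w v, h.swap₂₃ v w v, h.swap₁₂ v u, h.swap₁₂ w u, h.swap₁₂ w v,
    h.swap₂₃ v w u, h.swap₂₃ w w u, h.swap₂₃ w w v, h.swap₂₃ v v u]
  ring

/-- A singular point of the residual conic is a point at which the differential of the cubic form
vanishes on the plane. Hence it does not vanish on a vector outside of the plane. -/
theorem apply_ne_zero_of_ker (h : IsSymmTrilinear φ) (hns : IsNonsingularForm φ)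
    {u v w z : Fin 4 → ℂ} (hi : LinearIndependent ℂ ![u, v, w, z])
    (huuu : φ u u u = 0) (huuv : φ u u v = 0) (huvv : φ u v v = 0) (hvvv : φ v v v = 0)
    {x y t : ℂ} (h0 : x ≠ 0 ∨ y ≠ 0 ∨ t ≠ 0)
    (h1 : φ u u w * x + φ u v w * y + (φ u w w / 2) * t = 0)
    (h2 : φ u v w * x + φ v v w * y + (φ v w w / 2) * t = 0)
    (h3 : (φ u w w / 2) * x + (φ v w w / 2) * y + (φ w w w / 3) * t = 0) :
    φ (x • u + y • v + t • w) (x • u + y • v + t • w) z ≠ 0 := by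
  intro hz
  set p := x • u + y • v + t • w with hp
  have hp0 : p ≠ 0 := by
    intro hp0
    have := linearIndependent_four_iff.1 hi x y t 0 (by rw [← hp, hp0]; simp)
    tauto
  obtain ⟨q, hq⟩ := hns p hp0
  obtain ⟨a, b, c, d, rfl⟩ := hi.exists_combo_four q
  have k1 : φ p p u = 0 := by
    rw [hp, h.apply_combo_three, h.swap₂₃ u w u, h.swap₂₃ u v u, h.swap₂₃ v w u,
      h.swap₁₂ v u w, h.swap₂₃ w w u, h.swap₁₂ w u w, h.swap₂₃ v v u, h.swap₁₂ v u v,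
      huuu, huuv, huvv]
    linear_combination 2 * t * h1
  have k2 : φ p p v = 0 := by
    rw [hp, h.apply_combo_three, h.swap₂₃ u w v, h.swap₂₃ v w v,
      h.swap₂₃ w w v, h.swap₁₂ w v w, hvvv, huuv, huvv]
    linear_combination 2 * t * h2
  have k3 : φ p p w = 0 := by
    rw [hp, h.apply_combo_three]
    linear_combination x * h1 + y * h2 + 3 * t * h3
  apply hq
  simp only [map_add, map_smul, k1, k2, k3, hz, smul_zero, add_zero]

end IsSymmTrilinear

/-- The discriminant of the residual conic in the planes of the pencil spanned by `w` and `z`: a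
polynomial of degree at most `5` with simple roots. -/
theorem exists_residualDisc_polynomial
    {φ : (Fin 4 → ℂ) →ₗ[ℂ] (Fin 4 → ℂ) →ₗ[ℂ] (Fin 4 → ℂ) →ₗ[ℂ] ℂ}
    (h : IsSymmTrilinear φ) (hns : IsNonsingularForm φ)
    {u v w z : Fin 4 → ℂ} (hi : LinearIndependent ℂ ![u, v, w, z])
    (huuu : φ u u u = 0) (huuv : φ u u v = 0) (huvv : φ u v v = 0) (hvvv : φ v v v = 0) :
    ∃ Δ : Polynomial ℂ, (∀ s, Δ.eval s = residualDisc φ u v (w + s • z)) ∧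
      (∀ s, Δ.eval s = 0 → Δ.derivative.eval s ≠ 0) ∧ Δ.natDegree ≤ 5 ∧
      Δ.coeff 5 = residualDisc φ u v z := by
  let A : Polynomial ℂ := .C (φ u u w) + .C (φ u u z) * .X
  let B : Polynomial ℂ := .C (φ u v w) + .C (φ u v z) * .X
  let C : Polynomial ℂ := .C (φ v v w) + .C (φ v v z) * .X
  let D : Polynomial ℂ := .C (φ u w w / 2) + .C (φ u w z) * .X + .C (φ u z z / 2) * .X ^ 2
  let E : Polynomial ℂ := .C (φ v w w / 2) + .C (φ v w z) * .X + .C (φ v z z / 2) * .X ^ 2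
  let G : Polynomial ℂ := .C (φ w w w / 3) + .C (φ w w z) * .X + .C (φ w z z) * .X ^ 2
    + .C (φ z z z / 3) * .X ^ 3
  have hA : ∀ s, A.eval s = φ u u (w + s • z) := fun s => by simp [A]; ring
  have hB : ∀ s, B.eval s = φ u v (w + s • z) := fun s => by simp [B]; ring
  have hC : ∀ s, C.eval s = φ v v (w + s • z) := fun s => by simp [C]; ring
  have hD : ∀ s, D.eval s = φ u (w + s • z) (w + s • z) / 2 := fun s => by
    simp [D, h.swap₂₃ u z w]; ring
  have hE : ∀ s, E.eval s = φ v (w + s • z) (w + s • z) / 2 := fun s => by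
    simp [E, h.swap₂₃ v z w]; ring
  have hG : ∀ s, G.eval s = φ (w + s • z) (w + s • z) (w + s • z) / 3 := fun s => by
    simp [G, h.swap₁₂ z w, h.swap₂₃ w z w, h.swap₂₃ z z w]; ring
  have hA' : ∀ s, A.derivative.eval s = φ u u z := fun s => by simp [A]
  have hB' : ∀ s, B.derivative.eval s = φ u v z := fun s => by simp [B]
  have hC' : ∀ s, C.derivative.eval s = φ v v z := fun s => by simp [C]
  have hD' : ∀ s, D.derivative.eval s = φ u (w + s • z) z := fun s => by simp [D]; ring
  have hE' : ∀ s, E.derivative.eval s = φ v (w + s • z) z := fun s => by simp [E]; ring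
  have hG' : ∀ s, G.derivative.eval s = φ (w + s • z) (w + s • z) z := fun s => by
    simp [G, h.swap₁₂ z w]; ring
  refine ⟨A * C * G + 2 * B * D * E - A * E ^ 2 - B ^ 2 * G - C * D ^ 2, fun s => ?_,
    fun s hs => ?_, ?_, ?_⟩
  · simp only [Polynomial.eval_sub, Polynomial.eval_add, Polynomial.eval_mul,
      Polynomial.eval_pow, Polynomial.eval_ofNat, hA, hB, hC, hD, hE, hG, residualDisc]
  · simp only [Polynomial.eval_sub, Polynomial.eval_add, Polynomial.eval_mul,
      Polynomial.eval_pow, Polynomial.eval_ofNat, hA, hB, hC, hD, hE, hG] at hs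
    have hi' : LinearIndependent ℂ ![u, v, w + s • z, z] := by
      rw [linearIndependent_four_iff] at hi ⊢
      intro a b c d habcd
      obtain ⟨ha, hb, hc, hd⟩ := hi a b c (c * s + d) (by rw [← habcd]; module)
      refine ⟨ha, hb, hc, by simpa [hc] using hd⟩
    have := det_derivative_ne_zero hs fun x y t h0 h1 h2 h3 => by
      have := h.apply_ne_zero_of_ker hns hi' huuu huuv huvv hvvv h0 h1 h2 h3
      rwa [h.apply_combo_three] at this
    convert this using 1
    simp only [Polynomial.derivative_sub, Polynomial.derivative_add, Polynomial.derivative_mul,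
      Polynomial.derivative_pow, Polynomial.derivative_ofNat, Polynomial.eval_sub,
      Polynomial.eval_add, Polynomial.eval_mul, Polynomial.eval_pow, Polynomial.eval_ofNat,
      hA, hB, hC, hD, hE, hG, hA', hB', hC', hD', hE', hG', Polynomial.eval_zero,
      Polynomial.eval_C]
    push_cast
    ring
  · simp only [A, B, C, D, E, G]
    compute_degree
  · simp only [A, B, C, D, E, G]
    compute_degree!

/-- If the residual conic of a plane is singular, then every point of the cubic surface in the
plane, off the given line, lies on another line of the surface in this plane. -/
theorem exists_line_of_residualDisc_eq_zero
    {φ : (Fin 4 → ℂ) →ₗ[ℂ] (Fin 4 → ℂ) →ₗ[ℂ] (Fin 4 → ℂ) →ₗ[ℂ] ℂ}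
    (h : IsSymmTrilinear φ) {u v w z : Fin 4 → ℂ} (hi : LinearIndependent ℂ ![u, v, w, z])
    (huuu : φ u u u = 0) (huuv : φ u u v = 0) (huvv : φ u v v = 0) (hvvv : φ v v v = 0)
    (hdisc : residualDisc φ u v w = 0) {p : Fin 4 → ℂ}
    (hp : p ∈ Submodule.span ℂ {u, v, w}) (hpl : p ∉ Submodule.span ℂ {u, v})
    (hpp : φ p p p = 0) :
    ∃ m, IsLineOn φ m ∧ m ≤ Submodule.span ℂ {u, v, w} ∧ p ∈ m := by
  obtain ⟨x₀, y₀, t₀, rfl⟩ := Submodule.mem_span_triple.1 hp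
  have ht₀ : t₀ ≠ 0 := by
    rintro rfl
    exact hpl (Submodule.mem_span_pair.2 ⟨x₀, y₀, by simp⟩)
  rw [h.cube_combo_three huuu huuv huvv hvvv] at hpp
  have hq := (mul_eq_zero.1 hpp).resolve_left (mul_ne_zero three_ne_zero ht₀)
  clear hpp
  -- it suffices to find a second point of a line on the conic
  suffices H : ∃ x y t : ℂ, (∀ a b : ℂ, a * x₀ + b * x = 0 → a * y₀ + b * y = 0 →
      a * t₀ + b * t = 0 → a = 0 ∧ b = 0) ∧
      φ u u w * x ^ 2 + 2 * φ u v w * x * y + φ v v w * y ^ 2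
        + 2 * (φ u w w / 2) * x * t + 2 * (φ v w w / 2) * y * t + (φ w w w / 3) * t ^ 2 = 0 ∧
      (φ u u w * x₀ + φ u v w * y₀ + (φ u w w / 2) * t₀) * x
        + (φ u v w * x₀ + φ v v w * y₀ + (φ v w w / 2) * t₀) * y
        + ((φ u w w / 2) * x₀ + (φ v w w / 2) * y₀ + (φ w w w / 3) * t₀) * t = 0 by
    obtain ⟨x, y, t, hind, hq', hbil⟩ := H
    refine ⟨Submodule.span ℂ {x₀ • u + y₀ • v + t₀ • w, x • u + y • v + t • w},
      isLineOn_span_pair ?_ ?_, ?_, Submodule.subset_span (by simp)⟩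
    · rw [LinearIndependent.pair_iff]
      intro a b hab
      obtain ⟨h1, h2, h3, -⟩ := linearIndependent_four_iff.1 hi (a * x₀ + b * x)
        (a * y₀ + b * y) (a * t₀ + b * t) 0 (by rw [← hab]; module)
      exact hind a b h1 h2 h3
    · intro a b
      have : a • (x₀ • u + y₀ • v + t₀ • w) + b • (x • u + y • v + t • w) =
          (a * x₀ + b * x) • u + (a * y₀ + b * y) • v + (a * t₀ + b * t) • w := by module
      rw [this, h.cube_combo_three huuu huuv huvv hvvv]
      linear_combination 3 * (a * t₀ + b * t) * (a ^ 2 * hq + b ^ 2 * hq' + 2 * a * b * hbil)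
    · rw [Submodule.span_le]
      rintro q (rfl | rfl)
      · exact hp
      · exact Submodule.mem_span_triple.2 ⟨x, y, t, rfl⟩
  obtain ⟨n, hn0, hn⟩ := Matrix.exists_mulVec_eq_zero_iff.2
    (show (!![φ u u w, φ u v w, φ u w w / 2; φ u v w, φ v v w, φ v w w / 2;
      φ u w w / 2, φ v w w / 2, φ w w w / 3]).det = 0 by
        rw [Matrix.det_fin_three]
        simp only [residualDisc] at hdisc
        simp
        linear_combination hdisc)
  have k1 := congrFun hn 0
  have k2 := congrFun hn 1
  have k3 := congrFun hn 2
  simp [Matrix.mulVec, dotProduct, Fin.sum_univ_three] at k1 k2 k3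
  by_cases hc : ∃ c, n 0 = c * x₀ ∧ n 1 = c * y₀ ∧ n 2 = c * t₀
  · -- the point itself is the singular point of the conic: join it to a point of the given line
    obtain ⟨c, e0, e1, e2⟩ := hc
    have hc0 : c ≠ 0 := by
      rintro rfl
      apply hn0
      funext i
      fin_cases i
      · simpa using e0
      · simpa using e1
      · simpa using e2
    rw [e0, e1, e2] at k1 k2 k3
    obtain ⟨a, b, hab, hz⟩ := exists_binary_quadratic_zero (φ u u w) (φ u v w) (φ v v w)
    refine ⟨a, b, 0, fun r s h1 h2 h3 => ?_, by linear_combination hz, ?_⟩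
    · have hr : r = 0 := by simpa [ht₀] using h3
      subst hr
      refine ⟨rfl, ?_⟩
      by_contra hs
      simp [hs] at h1 h2
      tauto
    · apply mul_left_cancel₀ hc0
      linear_combination a * k1 + b * k2
  · refine ⟨n 0, n 1, n 2, fun r s h1 h2 h3 => ?_, by
      linear_combination n 0 * k1 + n 1 * k2 + n 2 * k3, by
      linear_combination x₀ * k1 + y₀ * k2 + t₀ * k3⟩
    have hs : s = 0 := by
      by_contra hs
      refine hc ⟨-r / s, ?_, ?_, ?_⟩ <;> field_simp
      · linear_combination h1
      · linear_combination h2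
      · linear_combination h3
    subst hs
    exact ⟨by simpa [ht₀] using h3, rfl⟩

/-- A plane through a line on a non-singular cubic surface contains a point of the surface off
the line. -/
theorem exists_point_off_line
    {φ : (Fin 4 → ℂ) →ₗ[ℂ] (Fin 4 → ℂ) →ₗ[ℂ] (Fin 4 → ℂ) →ₗ[ℂ] ℂ}
    (h : IsSymmTrilinear φ) (hns : IsNonsingularForm φ)
    {u v w z : Fin 4 → ℂ} (hi : LinearIndependent ℂ ![u, v, w, z])
    (huuu : φ u u u = 0) (huuv : φ u u v = 0) (huvv : φ u v v = 0) (hvvv : φ v v v = 0) :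
    ∃ p ∈ Submodule.span ℂ {u, v, w}, p ∉ Submodule.span ℂ {u, v} ∧ φ p p p = 0 := by
  -- the equation of the residual conic for `t = 1` is solvable, unless the conic is twice the line
  suffices H : ∃ x y : ℂ, φ u u w * x ^ 2 + 2 * φ u v w * x * y + φ v v w * y ^ 2
      + φ u w w * x + φ v w w * y + φ w w w / 3 = 0 by
    obtain ⟨x, y, hxy⟩ := H
    refine ⟨x • u + y • v + (1 : ℂ) • w, Submodule.mem_span_triple.2 ⟨x, y, 1, rfl⟩,
      fun hm => ?_, ?_⟩
    · obtain ⟨a, b, hab⟩ := Submodule.mem_span_pair.1 hm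
      have := linearIndependent_four_iff.1 hi (x - a) (y - b) 1 0 (by
        rw [← sub_eq_zero] at hab
        rw [← neg_eq_zero, ← hab]; module)
      exact one_ne_zero this.2.2.1
    · rw [h.cube_combo_three huuu huuv huvv hvvv]
      linear_combination 3 * hxy
  have root : ∀ a b c : ℂ, (a ≠ 0 ∨ b ≠ 0) → ∃ x : ℂ, a * x ^ 2 + b * x + c = 0 := by
    intro a b c hab
    by_cases ha : a = 0
    · have hb : b ≠ 0 := by tauto
      exact ⟨-c / b, by rw [ha]; field_simp; ring⟩
    · obtain ⟨s, hs⟩ := IsAlgClosed.exists_pow_nat_eq (b ^ 2 - 4 * a * c) (n := 2) (by norm_num)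
      refine ⟨(-b + s) / (2 * a), ?_⟩
      field_simp
      linear_combination hs
  by_cases hA : φ u u w ≠ 0 ∨ φ u w w ≠ 0
  · obtain ⟨x, hx⟩ := root _ _ (φ w w w / 3) hA
    exact ⟨x, 0, by linear_combination hx⟩
  by_cases hC : φ v v w ≠ 0 ∨ φ v w w ≠ 0
  · obtain ⟨y, hy⟩ := root _ _ (φ w w w / 3) hC
    exact ⟨0, y, by linear_combination hy⟩
  push Not at hA hC
  by_cases hB : φ u v w = 0
  · exfalso
    obtain ⟨a, b, hab, hz⟩ := exists_binary_quadratic_zero (φ u u z) (φ u v z) (φ v v z)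
    refine h.apply_ne_zero_of_ker hns hi huuu huuv huvv hvvv (x := a) (y := b) (t := 0)
      (by tauto) (by rw [hA.1, hB]; ring) (by rw [hC.1, hB]; ring)
      (by rw [hA.2, hC.2]; ring) ?_
    rw [h.apply_combo_three]
    linear_combination hz
  · refine ⟨1, -(φ w w w / 3) / (2 * φ u v w), ?_⟩
    rw [hA.1, hA.2, hC.1, hC.2]
    field_simp
    ring

/-- Through every line on a non-singular cubic surface there are five planes each of which cuts
out further lines. -/
theorem IsLineOn.exists_five_planes
    {φ : (Fin 4 → ℂ) →ₗ[ℂ] (Fin 4 → ℂ) →ₗ[ℂ] (Fin 4 → ℂ) →ₗ[ℂ] ℂ}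
    (h : IsSymmTrilinear φ) (hns : IsNonsingularForm φ)
    {l : Submodule ℂ (Fin 4 → ℂ)} (hl : IsLineOn φ l) :
    ∃ P : Fin 5 → Submodule ℂ (Fin 4 → ℂ), Function.Injective P ∧ ∀ i,
      Module.finrank ℂ (P i) = 3 ∧ l ≤ P i ∧ (∃ p ∈ P i, p ∉ l ∧ φ p p p = 0) ∧
      ∀ p ∈ P i, p ∉ l → φ p p p = 0 → ∃ m, IsLineOn φ m ∧ m ≤ P i ∧ p ∈ m := by
  obtain ⟨u, v, w, z, hi, rfl⟩ := hl.1.exists_frame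
  obtain ⟨huuu, huuv, huvv, hvvv⟩ := (h.cube_combo_eq_zero_iff u v).1 fun a b =>
    hl.2 _ (Submodule.mem_span_pair.2 ⟨a, b, rfl⟩)
  -- choose the basis such that the plane "at infinity" has a smooth residual conic
  obtain ⟨w, z, hi, hz⟩ : ∃ w z, LinearIndependent ℂ ![u, v, w, z] ∧
      residualDisc φ u v z ≠ 0 := by
    obtain ⟨Δ, h1, h2, -, -⟩ := exists_residualDisc_polynomial h hns hi huuu huuv huvv hvvv
    have hΔ : Δ ≠ 0 := by
      rintro rfl
      simpa using h2 0
    obtain ⟨s, hs⟩ : ∃ s, Δ.eval s ≠ 0 := by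
      by_contra! hc
      exact hΔ (Polynomial.funext fun s => by rw [hc, Polynomial.eval_zero])
    refine ⟨z, w + s • z, linearIndependent_four_iff.2 fun a b c d habcd => ?_, h1 s ▸ hs⟩
    obtain ⟨ha, hb, hd, hc⟩ := linearIndependent_four_iff.1 hi a b d (d * s + c)
      (by rw [← habcd]; module)
    exact ⟨ha, hb, by simpa [hd] using hc, hd⟩
  obtain ⟨Δ, h1, h2, h3, h4⟩ := exists_residualDisc_polynomial h hns hi huuu huuv huvv hvvv
  have hdeg : Δ.natDegree = 5 := le_antisymm h3 (Polynomial.le_natDegree_of_ne_zero (h4 ▸ hz))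
  have hΔ : Δ ≠ 0 := by
    rintro rfl
    simp at hdeg
  have hnodup : Δ.roots.Nodup := by
    rw [Multiset.nodup_iff_count_le_one]
    intro s
    rw [Polynomial.count_roots]
    by_contra! hc
    have := (Polynomial.one_lt_rootMultiplicity_iff_isRoot hΔ).1 hc
    exact h2 s this.1 this.2
  have hcard : Δ.roots.toFinset.card = 5 := by
    rw [Multiset.toFinset_card_of_nodup hnodup, ← hdeg]
    exact (IsAlgClosed.splits Δ).natDegree_eq_card_roots.symm
  let r := Δ.roots.toFinset.equivFinOfCardEq hcard
  have hr : ∀ i, residualDisc φ u v (w + (r.symm i : ℂ) • z) = 0 := by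
    intro i
    rw [← h1]
    have := (r.symm i).2
    rw [Multiset.mem_toFinset, Polynomial.mem_roots hΔ] at this
    exact this
  have hi' : ∀ s : ℂ, LinearIndependent ℂ ![u, v, w + s • z, z] := by
    intro s
    rw [linearIndependent_four_iff] at hi ⊢
    intro a b c d habcd
    obtain ⟨ha, hb, hc, hd⟩ := hi a b c (c * s + d) (by rw [← habcd]; module)
    exact ⟨ha, hb, hc, by simpa [hc] using hd⟩
  refine ⟨fun i => Submodule.span ℂ {u, v, w + (r.symm i : ℂ) • z}, fun i j hij => ?_,
    fun i => ⟨?_, Submodule.span_mono fun x => by simp; tauto, ?_, fun p hp hpl hpp => ?_⟩⟩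
  · beta_reduce at hij
    have hmem : w + (r.symm i : ℂ) • z ∈
        Submodule.span ℂ {u, v, w + (r.symm j : ℂ) • z} := by
      rw [← hij]; exact Submodule.subset_span (by simp)
    obtain ⟨a, b, c, habc⟩ := Submodule.mem_span_triple.1 hmem
    rw [← sub_eq_zero] at habc
    obtain ⟨-, -, hc, hd⟩ := linearIndependent_four_iff.1 hi a b (c - 1)
      (c * (r.symm j : ℂ) - (r.symm i : ℂ)) (by rw [← habc]; module)
    have : (r.symm j : ℂ) = (r.symm i : ℂ) := by linear_combination hd - (r.symm j : ℂ) * hc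
    exact (r.symm.injective (Subtype.ext this)).symm
  · have h3 : LinearIndependent ℂ ![u, v, w + (r.symm i : ℂ) • z] := by
      rw [Fintype.linearIndependent_iff]
      intro g hg
      rw [Fin.sum_univ_three] at hg
      obtain ⟨e0, e1, e2, -⟩ := linearIndependent_four_iff.1 (hi' (r.symm i)) (g 0) (g 1) (g 2) 0
        (by rw [zero_smul, add_zero]; exact hg)
      intro k
      fin_cases k
      exacts [e0, e1, e2]
    have := finrank_span_eq_card h3
    rwa [Matrix.range_cons, Matrix.range_cons_cons_empty, Fintype.card_fin] at this
  · exact exists_point_off_line h hns (hi' _) huuu huuv huvv hvvv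
  · exact exists_line_of_residualDisc_eq_zero h (hi' _) huuu huuv huvv hvvv (hr i) hp hpl hpp

/-! ### Two skew lines with five common transversals -/

/-- Two subspaces whose dimensions add up to more than that of a common overspace intersect. -/
theorem Submodule.inf_ne_bot_of_finrank_lt {p q s : Submodule ℂ (Fin 4 → ℂ)}
    (hp : p ≤ s) (hq : q ≤ s)
    (h : Module.finrank ℂ s < Module.finrank ℂ p + Module.finrank ℂ q) : p ⊓ q ≠ ⊥ := by
  intro hpq
  have h1 := Submodule.finrank_sup_add_finrank_inf_eq p q
  rw [hpq, finrank_bot] at h1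
  have h2 := Submodule.finrank_mono (sup_le hp hq)
  omega

/-- A non-singular cubic surface that contains a line contains two skew lines and five pairwise
skew lines meeting both. -/
theorem IsLineOn.exists_sevenLines
    {φ : (Fin 4 → ℂ) →ₗ[ℂ] (Fin 4 → ℂ) →ₗ[ℂ] (Fin 4 → ℂ) →ₗ[ℂ] ℂ}
    (h : IsSymmTrilinear φ) (hns : IsNonsingularForm φ)
    {l : Submodule ℂ (Fin 4 → ℂ)} (hl : IsLineOn φ l) :
    ∃ L : SevenLines, IsLineOn φ L.b₅ ∧ IsLineOn φ L.b₆ ∧ IsLineOn φ L.c₅₆ ∧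
      ∀ i, IsLineOn φ (L.a i) := by
  -- `b₅` and `b₆` are residual lines in two planes through the given line
  obtain ⟨b₅, b₆, hb₅, hb₆, hb⟩ : ∃ b₅ b₆, IsLineOn φ b₅ ∧ IsLineOn φ b₆ ∧ SkewLines b₅ b₆ := by
    obtain ⟨P, hPinj, hP⟩ := hl.exists_five_planes h hns
    have key : ∀ i, ∃ m, IsLineOn φ m ∧ m ≤ P i ∧ m ≠ l := by
      intro i
      obtain ⟨-, -, ⟨p, hpP, hpl, hpp⟩, hP4⟩ := hP i
      obtain ⟨m, hm, hmP, hpm⟩ := hP4 p hpP hpl hpp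
      exact ⟨m, hm, hmP, fun he => hpl (he ▸ hpm)⟩
    choose m hm hmP hml using key
    exact ⟨m 0, m 1, hm 0, hm 1, skewLines_of_plane_ne h hns hl (hm 0) (hm 1) (hP 0).1 (hP 1).1
      (hPinj.ne (by decide)) (hP 0).2.1 (hP 1).2.1 (hmP 0) (hmP 1) (hml 0) (hml 1)⟩
  -- each of the five planes through `b₅` meets `b₆` in a point, and there is a line through it
  obtain ⟨P, hPinj, hP⟩ := hb₅.exists_five_planes h hns
  have key : ∀ i, ∃ m, IsLineOn φ m ∧ m ≤ P i ∧ m ≠ b₅ ∧ LinesMeet m b₅ ∧ LinesMeet m b₆ := by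
    intro i
    obtain ⟨hP3, hbP, -, hP4⟩ := hP i
    have h5 : Module.finrank ℂ b₅ = 2 := hb₅.1
    have h6 : Module.finrank ℂ b₆ = 2 := hb₆.1
    obtain ⟨p, ⟨hpP, hp6⟩, hp0⟩ := Submodule.exists_mem_ne_zero_of_ne_bot
      (Submodule.inf_ne_bot_of_finrank_lt (p := P i) (q := b₆) le_top le_top (by
        rw [finrank_top, Module.finrank_fin_fun]; omega))
    have hp5 : p ∉ b₅ := fun hp5 => hp0 (by
      have : p ∈ b₅ ⊓ b₆ := ⟨hp5, hp6⟩
      rw [hb] at this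
      simpa using this)
    obtain ⟨m, hm, hmP, hpm⟩ := hP4 p hpP hp5 (hb₆.2 p hp6)
    have hm2 : Module.finrank ℂ m = 2 := hm.1
    refine ⟨m, hm, hmP, fun he => hp5 (he ▸ hpm),
      Submodule.inf_ne_bot_of_finrank_lt hmP hbP (by omega), fun he => hp0 ?_⟩
    have : p ∈ m ⊓ b₆ := ⟨hpm, hp6⟩
    rw [he] at this
    simpa using this
  choose m hm hmP hmb hm5 hm6 using key
  have hskew : ∀ i j, i ≠ j → SkewLines (m i) (m j) := fun i j hij =>
    skewLines_of_plane_ne h hns hb₅ (hm i) (hm j) (hP i).1 (hP j).1 (hPinj.ne hij) (hP i).2.1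
      (hP j).2.1 (hmP i) (hmP j) (hmb i) (hmb j)
  exact ⟨{
    b₅ := b₅
    b₆ := b₆
    c₅₆ := m 4
    a := fun i => m i.castSucc
    isProjLine_b₅ := hb₅.1
    isProjLine_b₆ := hb₆.1
    isProjLine_c₅₆ := (hm 4).1
    isProjLine_a := fun i => (hm _).1
    skew_b := hb
    skew_a := fun i j hij => hskew _ _ (Fin.castSucc_injective 4 |>.ne hij)
    skew_a_c₅₆ := fun i => hskew _ _ (Fin.castSucc_lt_last i).ne
    meet_a_b₅ := fun i => hm5 _
    meet_a_b₆ := fun i => hm6 _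
    meet_c₅₆_b₅ := hm5 4
    meet_c₅₆_b₆ := hm6 4 }, hb₅, hb₆, hm 4, fun i => hm _⟩

/-! ### Singular members of a pencil of cubic surfaces -/

/-- The quadratic form `φ(x, x, e k)`, for the `k`-th coordinate vector `e k`. -/
noncomputable def polarPolynomial
    (φ : (Fin 4 → ℂ) →ₗ[ℂ] (Fin 4 → ℂ) →ₗ[ℂ] (Fin 4 → ℂ) →ₗ[ℂ] ℂ) (k : Fin 4) :
    MvPolynomial (Fin 4) ℂ :=
  ∑ i, ∑ j, MvPolynomial.C (φ (Pi.single i 1) (Pi.single j 1) (Pi.single k 1)) *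
    (MvPolynomial.X i * MvPolynomial.X j)

theorem trilinear_apply_eq_sum
    (φ : (Fin 4 → ℂ) →ₗ[ℂ] (Fin 4 → ℂ) →ₗ[ℂ] (Fin 4 → ℂ) →ₗ[ℂ] ℂ) (x y z : Fin 4 → ℂ) :
    φ x y z = ∑ i, ∑ j, φ (Pi.single i 1) (Pi.single j 1) z * (x i * y j) := by
  conv_lhs => rw [pi_eq_sum_univ' x, pi_eq_sum_univ' y]
  simp only [map_sum, map_smul, LinearMap.sum_apply, LinearMap.smul_apply, smul_eq_mul,
    Finset.mul_sum]
  rw [Finset.sum_comm]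
  refine Finset.sum_congr rfl fun i _ => Finset.sum_congr rfl fun j _ => ?_
  ring

theorem eval_polarPolynomial
    (φ : (Fin 4 → ℂ) →ₗ[ℂ] (Fin 4 → ℂ) →ₗ[ℂ] (Fin 4 → ℂ) →ₗ[ℂ] ℂ) (k : Fin 4)
    (x : Fin 4 → ℂ) :
    MvPolynomial.eval x (polarPolynomial φ k) = φ x x (Pi.single k 1) := by
  rw [trilinear_apply_eq_sum]
  simp [polarPolynomial]

theorem polarPolynomial_isHomogeneous
    (φ : (Fin 4 → ℂ) →ₗ[ℂ] (Fin 4 → ℂ) →ₗ[ℂ] (Fin 4 → ℂ) →ₗ[ℂ] ℂ) (k : Fin 4) :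
    (polarPolynomial φ k).IsHomogeneous 2 := by
  refine MvPolynomial.IsHomogeneous.sum _ _ _ fun i _ =>
    MvPolynomial.IsHomogeneous.sum _ _ _ fun j _ => ?_
  have := (MvPolynomial.isHomogeneous_C (Fin 4)
    (φ (Pi.single i 1) (Pi.single j 1) (Pi.single k 1))).mul
    ((MvPolynomial.isHomogeneous_X ℂ i).mul (MvPolynomial.isHomogeneous_X ℂ j))
  simpa using this

theorem MvPolynomial.IsHomogeneous.homogeneousComponent_mul {σ R : Type*} [CommSemiring R]
    {q : MvPolynomial σ R} {m : ℕ} (hq : q.IsHomogeneous m) (p : MvPolynomial σ R) (n : ℕ) :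
    MvPolynomial.homogeneousComponent (n + m) (p * q) =
      MvPolynomial.homogeneousComponent n p * q := by
  let _ := MvPolynomial.gradedAlgebra (σ := σ) (R := R)
  have := DirectSum.coe_decompose_mul_of_right_mem_of_le
    (MvPolynomial.homogeneousSubmodule σ R) (a := p) (b := q) (i := m) (n := n + m) hq
    (Nat.le_add_left _ _)
  rw [Nat.add_sub_cancel] at this
  rw [← MvPolynomial.decomposition.decompose'_apply, ← MvPolynomial.decomposition.decompose'_apply]
  exact this

/-- By the Nullstellensatz, the polars of a non-singular cubic form generate all forms of some
degree. -/
theorem IsNonsingularForm.exists_degree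
    {φ : (Fin 4 → ℂ) →ₗ[ℂ] (Fin 4 → ℂ) →ₗ[ℂ] (Fin 4 → ℂ) →ₗ[ℂ] ℂ} (hns : IsNonsingularForm φ) :
    ∃ n : ℕ, ∀ p : MvPolynomial (Fin 4) ℂ, p.IsHomogeneous (n + 2) →
      ∃ g : Fin 4 → MvPolynomial (Fin 4) ℂ, (∀ k, (g k).IsHomogeneous n) ∧
        ∑ k, g k * polarPolynomial φ k = p := by
  let I := Ideal.span (Set.range (polarPolynomial φ))
  have hI : MvPolynomial.idealOfVars (Fin 4) ℂ ≤ I.radical := by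
    rw [← MvPolynomial.vanishingIdeal_zeroLocus_eq_radical (K := ℂ), MvPolynomial.idealOfVars,
      Ideal.span_le]
    rintro _ ⟨i, rfl⟩ x hx
    have hx0 : x = 0 := by
      by_contra hx0
      obtain ⟨v, hv⟩ := hns x hx0
      apply hv
      rw [pi_eq_sum_univ' v, map_sum]
      refine Finset.sum_eq_zero fun k _ => ?_
      have := hx (polarPolynomial φ k) (Ideal.subset_span ⟨k, rfl⟩)
      rw [MvPolynomial.aeval_eq_eval] at this
      rw [map_smul, ← eval_polarPolynomial, this, smul_zero]
    simp [hx0]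
  obtain ⟨n, hn⟩ := Ideal.exists_pow_le_of_le_radical_of_fg hI (MvPolynomial.idealOfVars_fg ..)
  refine ⟨n, fun p hp => ?_⟩
  have hpI : p ∈ I := hn <| by
    rw [MvPolynomial.mem_pow_idealOfVars_iff]
    intro d hd
    have := hp (MvPolynomial.mem_support_iff.1 hd)
    have h' : d.degree = n + 2 := by
      rw [Finsupp.degree_eq_weight_one (R := ℕ)]
      exact this
    omega
  obtain ⟨c, hc⟩ := Ideal.mem_span_range_iff_exists_fun.1 hpI
  refine ⟨fun k => MvPolynomial.homogeneousComponent n (c k),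
    fun k => MvPolynomial.homogeneousComponent_isHomogeneous _ _, ?_⟩
  rw [← MvPolynomial.homogeneousComponent_eq_self hp, ← hc, map_sum]
  exact Finset.sum_congr rfl fun k _ =>
    ((polarPolynomial_isHomogeneous φ k).homogeneousComponent_mul _ _).symm

/-- In a pencil of cubic forms spanned by a non-singular one and another one, only finitely many
parameters belong to singular forms: at a singular point for the parameter `s`, the evaluation of
forms of a suitable degree is an eigenvector of a fixed endomorphism, and the eigenvalue
determines `s`. -/
theorem IsNonsingularForm.finite_singular
    {φ : (Fin 4 → ℂ) →ₗ[ℂ] (Fin 4 → ℂ) →ₗ[ℂ] (Fin 4 → ℂ) →ₗ[ℂ] ℂ} (hns : IsNonsingularForm φ)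
    (φ₀ : (Fin 4 → ℂ) →ₗ[ℂ] (Fin 4 → ℂ) →ₗ[ℂ] (Fin 4 → ℂ) →ₗ[ℂ] ℂ) :
    {s : ℂ | ¬ IsNonsingularForm ((1 - s) • φ₀ + s • φ)}.Finite := by
  obtain ⟨n, hn⟩ := hns.exists_degree
  let W := MvPolynomial.homogeneousSubmodule (Fin 4) ℂ (n + 2)
  have : FiniteDimensional ℂ W :=
    Module.Finite.iff_fg.2 (MvPolynomial.homogeneousSubmodule_fg (n := n + 2) ..)
  let b := Module.finBasis ℂ W
  choose g hg hgsum using fun i => hn (b i) (b i).2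
  -- the endomorphism replaces the polars of `φ` by those of `φ₀ - φ`
  let T : W →ₗ[ℂ] W := b.constr ℂ fun i => ⟨∑ k, g i k * polarPolynomial (φ₀ - φ) k,
    MvPolynomial.IsHomogeneous.sum _ _ _ fun k _ =>
      (hg i k).mul (polarPolynomial_isHomogeneous _ k)⟩
  refine ((Module.End.finite_hasEigenvalue T.dualMap).image fun μ => 1 + μ⁻¹).subset ?_
  intro s hs
  obtain ⟨x, hx0, hx⟩ : ∃ x, x ≠ 0 ∧ ∀ v, ((1 - s) • φ₀ + s • φ) x x v = 0 := by
    simpa [IsNonsingularForm] using hs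
  let ev : Module.Dual ℂ W := (MvPolynomial.aeval x).toLinearMap ∘ₗ W.subtype
  have hev : ∀ p : W, ev p = MvPolynomial.eval x p := fun p => by
    simp [ev, MvPolynomial.aeval_eq_eval]
  have hT : ev = (-(1 - s)) • T.dualMap ev := by
    refine b.ext fun i => ?_
    rw [LinearMap.smul_apply, LinearMap.dualMap_apply, hev, hev]
    simp only [T, Module.Basis.constr_basis]
    rw [← hgsum i]
    simp only [map_sum, map_mul, eval_polarPolynomial, smul_eq_mul, Finset.mul_sum]
    refine Finset.sum_congr rfl fun k _ => ?_
    have := hx (Pi.single k 1)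
    simp only [LinearMap.add_apply, LinearMap.smul_apply, smul_eq_mul] at this
    simp only [LinearMap.sub_apply]
    linear_combination MvPolynomial.eval x (g i k) * this
  have hev0 : ev ≠ 0 := by
    obtain ⟨i, hi⟩ := Function.ne_iff.1 hx0
    intro h0
    have h1 : (MvPolynomial.X i ^ (n + 2) : MvPolynomial (Fin 4) ℂ) ∈ W := by
      have := (MvPolynomial.isHomogeneous_X ℂ i).pow (n + 2)
      rwa [one_mul] at this
    have h2 := hev ⟨_, h1⟩
    rw [h0] at h2
    simp at h2
    exact hi (pow_eq_zero_iff (by omega) |>.1 h2.symm)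
  have hs1 : -(1 - s) ≠ 0 := by
    intro h0
    rw [h0, zero_smul] at hT
    exact hev0 hT
  refine ⟨(-(1 - s))⁻¹, ?_, by simp⟩
  refine Module.End.hasEigenvalue_of_hasEigenvector
    (Module.End.hasEigenvector_iff.2 ⟨Module.End.mem_eigenspace_iff.2 ?_, hev0⟩)
  rw [eq_inv_smul_iff₀ hs1]
  exact hT.symm

/-! ### Deformation of lines and the existence of a line -/

theorem trilinear_apply_eq_sum_three
    (φ : (Fin 4 → ℂ) →ₗ[ℂ] (Fin 4 → ℂ) →ₗ[ℂ] (Fin 4 → ℂ) →ₗ[ℂ] ℂ) (x y z : Fin 4 → ℂ) :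
    φ x y z = ∑ i, ∑ j, ∑ k, φ (Pi.single i 1) (Pi.single j 1) (Pi.single k 1) *
      (x i * y j * z k) := by
  rw [trilinear_apply_eq_sum]
  refine Finset.sum_congr rfl fun i _ => Finset.sum_congr rfl fun j _ => ?_
  conv_lhs => rw [pi_eq_sum_univ' z, map_sum, Finset.sum_mul]
  refine Finset.sum_congr rfl fun k _ => ?_
  rw [map_smul, smul_eq_mul]
  ring

theorem continuous_cube (φ : (Fin 4 → ℂ) →ₗ[ℂ] (Fin 4 → ℂ) →ₗ[ℂ] (Fin 4 → ℂ) →ₗ[ℂ] ℂ) :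
    Continuous fun x => φ x x x := by
  rw [funext fun x => trilinear_apply_eq_sum_three φ x x x]
  fun_prop

/-- In a pencil of cubic surfaces, the parameters of those surfaces that contain a line form a
closed set, because the lines, given by orthonormal bases, form a compact space. -/
theorem isClosed_setOf_exists_isLineOn
    (φ₀ φ : (Fin 4 → ℂ) →ₗ[ℂ] (Fin 4 → ℂ) →ₗ[ℂ] (Fin 4 → ℂ) →ₗ[ℂ] ℂ) :
    IsClosed {s : ℂ | ∃ l, IsLineOn ((1 - s) • φ₀ + s • φ) l} := by
  let K : Set (EuclideanSpace ℂ (Fin 4) × EuclideanSpace ℂ (Fin 4)) :=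
    (Metric.sphere 0 1 ×ˢ Metric.sphere 0 1) ∩ {p | inner ℂ p.1 p.2 = 0}
  have hK : IsCompact K :=
    ((isCompact_sphere _ _).prod (isCompact_sphere _ _)).inter_right
      (isClosed_eq (by fun_prop) (by fun_prop))
  have : CompactSpace K := isCompact_iff_compactSpace.1 hK
  let Z : Set (ℂ × K) := {q | ∀ a b : ℂ, ((1 - q.1) • φ₀ + q.1 • φ)
    (a • q.2.1.1.ofLp + b • q.2.1.2.ofLp) (a • q.2.1.1.ofLp + b • q.2.1.2.ofLp)
    (a • q.2.1.1.ofLp + b • q.2.1.2.ofLp) = 0}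
  have hZ : IsClosed Z := by
    simp only [Z, Set.ofPred_forall]
    refine isClosed_iInter fun a => isClosed_iInter fun b => isClosed_eq ?_ (by fun_prop)
    simp only [LinearMap.add_apply, LinearMap.smul_apply, smul_eq_mul]
    have hc : Continuous fun q : ℂ × K => a • q.2.1.1.ofLp + b • q.2.1.2.ofLp := by fun_prop
    have h0 := (continuous_cube φ₀).comp hc
    have h1 := (continuous_cube φ).comp hc
    simp only [Function.comp_def] at h0 h1
    exact ((continuous_const.sub continuous_fst).mul h0).add (continuous_fst.mul h1)
  convert isClosedMap_fst_of_compactSpace (X := ℂ) (Y := K) Z hZ using 1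
  ext s
  constructor
  · rintro ⟨l, hl, hls⟩
    let l' := l.map (WithLp.linearEquiv 2 ℂ (Fin 4 → ℂ)).symm.toLinearMap
    have hl' : Module.finrank ℂ l' = 2 := by
      rw [← hl]
      exact LinearEquiv.finrank_map_eq _ _
    let b := (stdOrthonormalBasis ℂ l').reindex (finCongr hl')
    have hmem : ∀ i, (b i : EuclideanSpace ℂ (Fin 4)).ofLp ∈ l := by
      intro i
      obtain ⟨y, hy, hyi⟩ := (b i).2
      rw [← hyi]
      exact hy
    refine ⟨⟨s, ⟨⟨b 0, b 1⟩, ⟨⟨?_, ?_⟩, ?_⟩⟩⟩, fun a c => hls _ ?_, rfl⟩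
    · simp only [mem_sphere_zero_iff_norm]
      exact b.orthonormal.1 0
    · simp only [mem_sphere_zero_iff_norm]
      exact b.orthonormal.1 1
    · exact b.orthonormal.2 (show (0 : Fin 2) ≠ 1 by decide)
    · exact l.add_mem (l.smul_mem _ (hmem 0)) (l.smul_mem _ (hmem 1))
  · rintro ⟨⟨s, ⟨⟨p, q⟩, ⟨⟨hp, hq⟩, hpq⟩⟩⟩, hZs, rfl⟩
    refine ⟨_, isLineOn_span_pair (u := p.ofLp) (v := q.ofLp) ?_ hZs⟩
    rw [LinearIndependent.pair_iff]
    intro a b hab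
    have hab' : a • p + b • q = 0 := by
      ext i
      exact congrFun hab i
    simp only [mem_sphere_zero_iff_norm] at hp hq
    simp only [Set.mem_ofPred_eq] at hpq
    have e1 := congrArg (inner ℂ p) hab'
    have e2 := congrArg (inner ℂ q) hab'
    rw [inner_add_right, inner_smul_right, inner_smul_right, inner_zero_right] at e1 e2
    rw [hpq, inner_self_eq_norm_sq_to_K, hp] at e1
    rw [inner_eq_zero_symm.1 hpq, inner_self_eq_norm_sq_to_K, hq] at e2
    constructor
    · simpa using e1
    · simpa using e2

/-- A line on a non-singular cubic surface admits no infinitesimal deformation on the surface. -/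
theorem IsNonsingularForm.deformation_eq_zero
    {φ : (Fin 4 → ℂ) →ₗ[ℂ] (Fin 4 → ℂ) →ₗ[ℂ] (Fin 4 → ℂ) →ₗ[ℂ] ℂ}
    (h : IsSymmTrilinear φ) (hns : IsNonsingularForm φ)
    {u v w z : Fin 4 → ℂ} (hi : LinearIndependent ℂ ![u, v, w, z])
    (huuu : φ u u u = 0) (huuv : φ u u v = 0) (huvv : φ u v v = 0) (hvvv : φ v v v = 0)
    {p₀ p₁ p₂ p₃ : ℂ} (h1 : φ u u (p₀ • w + p₁ • z) = 0)
    (h2 : 2 * φ u v (p₀ • w + p₁ • z) + φ u u (p₂ • w + p₃ • z) = 0)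
    (h3 : φ v v (p₀ • w + p₁ • z) + 2 * φ u v (p₂ • w + p₃ • z) = 0)
    (h4 : φ v v (p₂ • w + p₃ • z) = 0) : p₀ = 0 ∧ p₁ = 0 ∧ p₂ = 0 ∧ p₃ = 0 := by
  -- the partial derivatives in the directions `w` and `z` have no common zero on the line
  have key : ∀ a b : ℂ, (a ≠ 0 ∨ b ≠ 0) →
      a ^ 2 * φ u u w + 2 * a * b * φ u v w + b ^ 2 * φ v v w = 0 →
      a ^ 2 * φ u u z + 2 * a * b * φ u v z + b ^ 2 * φ v v z = 0 → False := by
    intro a b hab hw hz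
    rw [← h.apply_combo] at hw hz
    have hx : a • u + b • v ≠ 0 := by
      intro hx
      have := linearIndependent_four_iff.1 hi a b 0 0 (by rw [hx]; simp)
      tauto
    obtain ⟨y, hy⟩ := hns _ hx
    obtain ⟨c, d, e, f, rfl⟩ := hi.exists_combo_four y
    have ku : φ (a • u + b • v) (a • u + b • v) u = 0 := by
      rw [h.apply_combo, h.swap₂₃ u v u, h.swap₂₃ v v u, h.swap₁₂ v u v, huuu, huuv, huvv]
      ring
    have kv : φ (a • u + b • v) (a • u + b • v) v = 0 := by
      rw [h.apply_combo, hvvv, huuv, huvv]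
      ring
    apply hy
    rw [map_add, map_add, map_add, map_smul, map_smul, map_smul, map_smul, ku, kv, hw, hz]
    simp
  -- the partial derivative in a direction outside of the line does not vanish on the line
  have key' : ∀ m n : ℂ, (m ≠ 0 ∨ n ≠ 0) → φ u u (m • w + n • z) = 0 →
      φ u v (m • w + n • z) = 0 → φ v v (m • w + n • z) = 0 → False := by
    intro m n hmn k1 k2 k3
    simp only [map_add, map_smul, smul_eq_mul] at k1 k2 k3
    by_cases hm : m = 0
    · have hn : n ≠ 0 := by tauto
      obtain ⟨a, b, hab, hq⟩ := exists_binary_quadratic_zero (φ u u w) (φ u v w) (φ v v w)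
      refine key a b hab (by linear_combination hq) (mul_left_cancel₀ hn ?_)
      rw [hm] at k1 k2 k3
      linear_combination a ^ 2 * k1 + 2 * a * b * k2 + b ^ 2 * k3
    · obtain ⟨a, b, hab, hq⟩ := exists_binary_quadratic_zero (φ u u z) (φ u v z) (φ v v z)
      refine key a b hab (mul_left_cancel₀ hm ?_) (by linear_combination hq)
      linear_combination a ^ 2 * k1 + 2 * a * b * k2 + b ^ 2 * k3 - n * hq
  by_contra hp
  by_cases hdet : p₀ * p₃ - p₁ * p₂ = 0
  · by_cases h01 : p₀ = 0 ∧ p₁ = 0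
    · obtain ⟨rfl, rfl⟩ := h01
      simp only [zero_smul, add_zero, map_zero, mul_zero, zero_add] at h1 h2 h3 h4
      exact key' p₂ p₃ (by tauto) h2 (by simpa using h3) h4
    · obtain ⟨k, hk2, hk3⟩ : ∃ k, p₂ = k * p₀ ∧ p₃ = k * p₁ := by
        by_cases h0 : p₀ = 0
        · have h1 : p₁ ≠ 0 := by tauto
          refine ⟨p₃ / p₁, ?_, by field_simp⟩
          rw [h0] at hdet ⊢
          have : p₁ * p₂ = 0 := by linear_combination -hdet
          simpa [h1] using this
        · refine ⟨p₂ / p₀, by field_simp, ?_⟩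
          field_simp
          linear_combination hdet
      have hk : p₂ • w + p₃ • z = k • (p₀ • w + p₁ • z) := by rw [hk2, hk3]; module
      rw [hk, map_smul, smul_eq_mul] at h2 h3
      have e2 : φ u v (p₀ • w + p₁ • z) = 0 := by linear_combination (1 / 2) * h2 - k / 2 * h1
      exact key' p₀ p₁ (by tauto) h1 e2 (by linear_combination h3 - 2 * k * e2)
  · -- the two derivatives are `b m` and `-a m`, with a linear form `m` that has a zero
    obtain ⟨a, b, hab, k1, k2⟩ : ∃ a b : ℂ, (a ≠ 0 ∨ b ≠ 0) ∧
        a ^ 2 * φ u u (p₀ • w + p₁ • z) + 2 * a * b * φ u v (p₀ • w + p₁ • z)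
          + b ^ 2 * φ v v (p₀ • w + p₁ • z) = 0 ∧
        a ^ 2 * φ u u (p₂ • w + p₃ • z) + 2 * a * b * φ u v (p₂ • w + p₃ • z)
          + b ^ 2 * φ v v (p₂ • w + p₃ • z) = 0 := by
      by_cases hm : φ v v (p₀ • w + p₁ • z) = 0 ∧ 2 * φ u v (p₀ • w + p₁ • z) = 0
      · exact ⟨1, 0, by simp, by rw [h1]; ring, by linear_combination h2 - hm.2⟩
      · refine ⟨φ v v (p₀ • w + p₁ • z), -(2 * φ u v (p₀ • w + p₁ • z)), ?_, ?_, ?_⟩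
        · by_contra! hc
          exact hm ⟨hc.1, neg_eq_zero.1 hc.2⟩
        · rw [h1]; ring
        · rw [h4]
          linear_combination φ v v (p₀ • w + p₁ • z) ^ 2 * h2
            - 2 * φ v v (p₀ • w + p₁ • z) * φ u v (p₀ • w + p₁ • z) * h3
    simp only [map_add, map_smul, smul_eq_mul] at k1 k2
    refine key a b hab (mul_left_cancel₀ hdet ?_) (mul_left_cancel₀ hdet ?_)
    · linear_combination p₃ * k1 - p₁ * k2
    · linear_combination p₀ * k2 - p₂ * k1

theorem hasDerivAt_trilinear_line
    (φ : (Fin 4 → ℂ) →ₗ[ℂ] (Fin 4 → ℂ) →ₗ[ℂ] (Fin 4 → ℂ) →ₗ[ℂ] ℂ) (x y z x' y' z' : Fin 4 → ℂ) :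
    HasDerivAt (fun τ : ℂ => φ (x + τ • x') (y + τ • y') (z + τ • z'))
      (φ x' y z + φ x y' z + φ x y z') 0 := by
  have h : (fun τ : ℂ => φ (x + τ • x') (y + τ • y') (z + τ • z')) = fun τ =>
      φ x y z + (φ x' y z + φ x y' z + φ x y z') * τ
        + (φ x' y' z + φ x y' z' + φ x' y z') * τ ^ 2 + φ x' y' z' * τ ^ 3 := by
    funext τ
    simp only [map_add, map_smul, LinearMap.add_apply, LinearMap.smul_apply, smul_eq_mul]
    ring
  rw [h]
  have h1 := (hasDerivAt_id (0 : ℂ)).const_mul (φ x' y z + φ x y' z + φ x y z')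
  have h2 := ((hasDerivAt_id (0 : ℂ)).pow 2).const_mul (φ x' y' z + φ x y' z' + φ x' y z')
  have h3 := ((hasDerivAt_id (0 : ℂ)).pow 3).const_mul (φ x' y' z')
  exact (((h1.const_add (φ x y z)).add h2).add h3).congr_deriv (by simp)

/-- A line on a non-singular cubic surface deforms with the surface, by the implicit function
theorem. -/
theorem eventually_exists_isLineOn
    {φ₀ φ : (Fin 4 → ℂ) →ₗ[ℂ] (Fin 4 → ℂ) →ₗ[ℂ] (Fin 4 → ℂ) →ₗ[ℂ] ℂ}
    (h₀ : IsSymmTrilinear φ₀) (h : IsSymmTrilinear φ) {s₀ : ℂ}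
    (hns : IsNonsingularForm ((1 - s₀) • φ₀ + s₀ • φ)) {l : Submodule ℂ (Fin 4 → ℂ)}
    (hl : IsLineOn ((1 - s₀) • φ₀ + s₀ • φ) l) :
    ∀ᶠ s in nhds s₀, ∃ l, IsLineOn ((1 - s) • φ₀ + s • φ) l := by
  set ψ : ℂ → ((Fin 4 → ℂ) →ₗ[ℂ] (Fin 4 → ℂ) →ₗ[ℂ] (Fin 4 → ℂ) →ₗ[ℂ] ℂ) :=
    fun s => (1 - s) • φ₀ + s • φ with hψ
  have hψs : ∀ s, IsSymmTrilinear (ψ s) := fun s =>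
    ⟨fun x y z => by
      simp only [hψ, LinearMap.add_apply, LinearMap.smul_apply, h₀.swap₁₂ x y z, h.swap₁₂ x y z],
    fun x y z => by
      simp only [hψ, LinearMap.add_apply, LinearMap.smul_apply, h₀.swap₂₃ x y z, h.swap₂₃ x y z]⟩
  change IsNonsingularForm (ψ s₀) at hns
  change IsLineOn (ψ s₀) l at hl
  obtain ⟨u, v, w, z, hi, rfl⟩ := hl.1.exists_frame
  obtain ⟨huuu, huuv, huvv, hvvv⟩ := ((hψs s₀).cube_combo_eq_zero_iff u v).1 fun a b =>
    hl.2 _ (Submodule.mem_span_pair.2 ⟨a, b, rfl⟩)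
  -- the four coefficients of the cubic form on a neighbouring line
  let U : (Fin 4 → ℂ) → (Fin 4 → ℂ) := fun p => u + (p 0 • w + p 1 • z)
  let V : (Fin 4 → ℂ) → (Fin 4 → ℂ) := fun p => v + (p 2 • w + p 3 • z)
  let f : ℂ × (Fin 4 → ℂ) → ℂ × ℂ × ℂ × ℂ × ℂ := fun q => (q.1,
    ψ q.1 (U q.2) (U q.2) (U q.2), ψ q.1 (U q.2) (U q.2) (V q.2),
    ψ q.1 (U q.2) (V q.2) (V q.2), ψ q.1 (V q.2) (V q.2) (V q.2))
  have hsmooth : ∀ X Y Z : (Fin 4 → ℂ) → (Fin 4 → ℂ), ContDiff ℂ 1 X → ContDiff ℂ 1 Y →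
      ContDiff ℂ 1 Z → ContDiff ℂ 1 fun q : ℂ × (Fin 4 → ℂ) => ψ q.1 (X q.2) (Y q.2) (Z q.2) := by
    intro X Y Z hX hY hZ
    have h1 : ∀ θ : (Fin 4 → ℂ) →ₗ[ℂ] (Fin 4 → ℂ) →ₗ[ℂ] (Fin 4 → ℂ) →ₗ[ℂ] ℂ,
        ContDiff ℂ 1 fun q : ℂ × (Fin 4 → ℂ) => θ (X q.2) (Y q.2) (Z q.2) := by
      intro θ
      rw [funext fun q : ℂ × (Fin 4 → ℂ) =>
        trilinear_apply_eq_sum_three θ (X q.2) (Y q.2) (Z q.2)]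
      fun_prop
    simp only [hψ, LinearMap.add_apply, LinearMap.smul_apply, smul_eq_mul]
    exact ((contDiff_const.sub contDiff_fst).mul (h1 φ₀)).add (contDiff_fst.mul (h1 φ))
  have hU : ContDiff ℂ 1 U := by fun_prop
  have hV : ContDiff ℂ 1 V := by fun_prop
  have hf : ContDiff ℂ 1 f :=
    contDiff_fst.prodMk <| (hsmooth U U U hU hU hU).prodMk <| (hsmooth U U V hU hU hV).prodMk <|
      (hsmooth U V V hU hV hV).prodMk (hsmooth V V V hV hV hV)
  have hfa : HasStrictFDerivAt f (fderiv ℂ f (s₀, 0)) (s₀, 0) :=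
    hf.contDiffAt.hasStrictFDerivAt one_ne_zero
  have hU0 : U 0 = u := by simp [U]
  have hV0 : V 0 = v := by simp [V]
  have hinj : Function.Injective (fderiv ℂ f (s₀, 0)) := by
    rw [injective_iff_map_eq_zero]
    rintro ⟨ds, p⟩ hd
    -- the derivative of `f` along a line through the base point
    have hline : HasDerivAt (fun τ : ℂ => f (s₀ + τ * ds, τ • p)) 0 0 := by
      have hγ : HasDerivAt (fun τ : ℂ => ((s₀ + τ * ds, τ • p) : ℂ × (Fin 4 → ℂ))) (ds, p) 0 := by
        have h1 := ((hasDerivAt_id (0 : ℂ)).mul_const ds).const_add s₀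
        have h2 := (hasDerivAt_id (0 : ℂ)).smul_const p
        simpa using h1.prodMk h2
      have hfa' : HasFDerivAt f (fderiv ℂ f (s₀, 0)) (s₀ + (0 : ℂ) * ds, (0 : ℂ) • p) := by
        simpa using hfa.hasFDerivAt
      have := hfa'.comp_hasDerivAt (0 : ℂ) hγ
      rwa [hd] at this
    have hds : ds = 0 := by
      have h1 := hline.fst
      have h2 := ((hasDerivAt_id (0 : ℂ)).mul_const ds).const_add s₀
      simpa using h2.unique h1
    subst hds
    have hUτ : ∀ τ : ℂ, U (τ • p) = u + τ • (p 0 • w + p 1 • z) := fun τ => by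
      simp only [U, Pi.smul_apply, smul_eq_mul]; module
    have hVτ : ∀ τ : ℂ, V (τ • p) = v + τ • (p 2 • w + p 3 • z) := fun τ => by
      simp only [V, Pi.smul_apply, smul_eq_mul]; module
    simp only [f, mul_zero, add_zero, hUτ, hVτ] at hline
    have hs := (hψs s₀).swap₁₂
    have ht := (hψs s₀).swap₂₃
    have e1 := (hasDerivAt_trilinear_line (ψ s₀) _ _ _ _ _ _).unique hline.snd.fst
    have e2 := (hasDerivAt_trilinear_line (ψ s₀) _ _ _ _ _ _).unique hline.snd.snd.fst
    have e3 := (hasDerivAt_trilinear_line (ψ s₀) _ _ _ _ _ _).unique hline.snd.snd.snd.fst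
    have e4 := (hasDerivAt_trilinear_line (ψ s₀) _ _ _ _ _ _).unique hline.snd.snd.snd.snd
    simp only [Prod.fst_zero, Prod.snd_zero] at e1 e2 e3 e4
    rw [hs _ u u, ht u _ u] at e1
    rw [hs _ u v, ht u _ v] at e2
    rw [hs _ v v, ht v _ v, ht u _ v] at e3
    rw [hs _ v v, ht v _ v] at e4
    obtain ⟨h0, h1, h2, h3⟩ := hns.deformation_eq_zero (hψs s₀) hi huuu huuv huvv hvvv
      (p₀ := p 0) (p₁ := p 1) (p₂ := p 2) (p₃ := p 3)
      (by linear_combination (1 / 3) * e1) (by linear_combination e2)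
      (by linear_combination e3) (by linear_combination (1 / 3) * e4)
    refine Prod.ext rfl (funext fun i => ?_)
    fin_cases i
    exacts [h0, h1, h2, h3]
  have hsurj : (fderiv ℂ f (s₀, 0)).range = ⊤ := by
    rw [LinearMap.range_eq_top]
    refine (LinearMap.injective_iff_surjective_of_finrank_eq_finrank
      (f := (fderiv ℂ f (s₀, 0)).toLinearMap) ?_).1 hinj
    simp
  have hnhds := hfa.map_nhds_eq_of_surj hsurj
  have hfa0 : f (s₀, 0) = (s₀, 0, 0, 0, 0) := by
    simp only [f, hU0, hV0, huuu, huuv, huvv, hvvv]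
  rw [hfa0] at hnhds
  have hrange : Set.range f ∈ nhds ((s₀, 0, 0, 0, 0) : ℂ × ℂ × ℂ × ℂ × ℂ) := by
    rw [← hnhds]
    exact Filter.range_mem_map
  have hcont : Continuous fun s : ℂ => ((s, 0, 0, 0, 0) : ℂ × ℂ × ℂ × ℂ × ℂ) := by fun_prop
  filter_upwards [hcont.continuousAt.preimage_mem_nhds hrange] with s hs
  obtain ⟨⟨s', p⟩, hp⟩ := hs
  simp only [f, Prod.mk.injEq] at hp
  obtain ⟨rfl, k1, k2, k3, k4⟩ := hp
  refine ⟨_, isLineOn_span_pair (u := U p) (v := V p) ?_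
    (((hψs s').cube_combo_eq_zero_iff _ _).2 ⟨k1, k2, k3, k4⟩)⟩
  rw [LinearIndependent.pair_iff]
  intro a b hab
  have := linearIndependent_four_iff.1 hi a b (a * p 0 + b * p 2) (a * p 1 + b * p 3) (by
    rw [← hab]; simp only [U, V]; module)
  exact ⟨this.1, this.2.1⟩

/-- Every non-singular cubic surface contains a line. The Fermat cubic does, and in the pencil
that joins it to the given surface the existence of a line is an open and closed condition on the
parameters of non-singular surfaces, which form a connected set. -/
theorem IsNonsingularForm.exists_isLineOn
    {φ : (Fin 4 → ℂ) →ₗ[ℂ] (Fin 4 → ℂ) →ₗ[ℂ] (Fin 4 → ℂ) →ₗ[ℂ] ℂ}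
    (h : IsSymmTrilinear φ) (hns : IsNonsingularForm φ) : ∃ l, IsLineOn φ l := by
  let φ₀ : (Fin 4 → ℂ) →ₗ[ℂ] (Fin 4 → ℂ) →ₗ[ℂ] (Fin 4 → ℂ) →ₗ[ℂ] ℂ :=
    ∑ i, coordTrilinear i i i
  have hφ₀ : ∀ x y z, φ₀ x y z = ∑ i, x i * y i * z i := fun x y z => by
    simp [φ₀, LinearMap.sum_apply, coordTrilinear_apply]
  have h₀ : IsSymmTrilinear φ₀ :=
    ⟨fun x y z => by simp only [hφ₀, mul_comm (x _)], fun x y z => by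
      simp only [hφ₀, mul_right_comm]⟩
  have hns₀ : IsNonsingularForm φ₀ := by
    intro x hx
    obtain ⟨i, hi⟩ := Function.ne_iff.1 hx
    refine ⟨Pi.single i 1, ?_⟩
    simpa [hφ₀, Pi.single_apply] using hi
  have hl₀ : ∃ l, IsLineOn φ₀ l := by
    refine ⟨_, isLineOn_span_pair (u := ![1, -1, 0, 0]) (v := ![0, 0, 1, -1]) ?_ fun a b => ?_⟩
    · rw [LinearIndependent.pair_iff]
      intro a b hab
      exact ⟨by simpa using congrFun hab 0, by simpa using congrFun hab 2⟩
    · rw [hφ₀, Fin.sum_univ_four]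
      simp
  let T : Set ℂ := {s | ∃ l, IsLineOn ((1 - s) • φ₀ + s • φ) l}
  let N : Set ℂ := {s | ¬ IsNonsingularForm ((1 - s) • φ₀ + s • φ)}ᶜ
  have hN : IsPreconnected N :=
    ((hns.finite_singular φ₀).countable.isConnected_compl_of_one_lt_rank (by simp)).isPreconnected
  have hT : IsClosed T := isClosed_setOf_exists_isLineOn φ₀ φ
  have hsub : T ∩ N ⊆ interior T := by
    rintro s ⟨⟨l, hl⟩, hs⟩
    rw [mem_interior_iff_mem_nhds]
    exact eventually_exists_isLineOn h₀ h (not_not.1 hs) hl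
  have h0 : (0 : ℂ) ∈ N := by simpa [N] using hns₀
  have h1 : (1 : ℂ) ∈ N := by simpa [N] using hns
  have hNT := hN.subset_of_closure_inter_subset (u := interior T) isOpen_interior
    ⟨0, h0, hsub ⟨by simpa [T] using hl₀, h0⟩⟩
    fun s hs => hsub ⟨hT.closure_interior_subset hs.1, hs.2⟩
  simpa [T] using interior_subset (hNT h1)

/-! ### Intersection points and cross ratios -/

theorem Submodule.span_singleton_eq_of_mem {V : Type*} [AddCommGroup V] [Module ℂ V] {u v : V}
    (hv : v ≠ 0) (h : v ∈ Submodule.span ℂ {u}) :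
    Submodule.span ℂ {v} = Submodule.span ℂ {u} := by
  obtain ⟨a, rfl⟩ := Submodule.mem_span_singleton.1 h
  have ha : a ≠ 0 := by
    rintro rfl
    simp at hv
  exact Submodule.span_singleton_smul_eq (IsUnit.mk0 a ha) u

/-- If two skew lines meet the line `k`, then each of them meets it in exactly one point. -/
theorem LinesMeet.exists_inf_eq_span {m m' k : Submodule ℂ (Fin 4 → ℂ)} (hm : IsProjLine m)
    (hk : IsProjLine k) (hmk : LinesMeet m k) (hm'k : LinesMeet m' k) (hmm' : SkewLines m m') :
    ∃ p, p ≠ 0 ∧ m ⊓ k = Submodule.span ℂ {p} := by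
  unfold IsProjLine at hm hk
  have hne : m ⊓ k ≠ m := by
    intro he
    have hmk' : m = k := Submodule.eq_of_le_of_finrank_eq (inf_eq_left.1 he) (hm.trans hk.symm)
    subst hmk'
    exact hm'k (by rw [inf_comm]; exact hmm')
  have h1 := Submodule.finrank_lt_finrank_of_lt (lt_of_le_of_ne inf_le_left hne)
  obtain ⟨p, hp, hp0⟩ := Submodule.exists_mem_ne_zero_of_ne_bot hmk
  refine ⟨p, hp0, (Submodule.eq_of_le_of_finrank_le ?_ ?_).symm⟩
  · rwa [Submodule.span_singleton_le_iff_mem]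
  · rw [finrank_span_singleton hp0]
    omega

theorem SkewLines.linearIndependent {m m' : Submodule ℂ (Fin 4 → ℂ)} (h : SkewLines m m')
    {p q : Fin 4 → ℂ} (hp : p ≠ 0) (hq : q ≠ 0) (hpm : p ∈ m) (hqm : q ∈ m') :
    LinearIndependent ℂ ![p, q] := by
  rw [LinearIndependent.pair_iff]
  intro a b hab
  have h1 : a • p = 0 := by
    have : a • p ∈ m ⊓ m' := by
      refine ⟨m.smul_mem a hpm, ?_⟩
      rw [eq_neg_of_add_eq_zero_left hab]
      exact m'.neg_mem (m'.smul_mem b hqm)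
    rw [h] at this
    simpa using this
  rw [h1, zero_add] at hab
  exact ⟨(smul_eq_zero.1 h1).resolve_right hp, (smul_eq_zero.1 hab).resolve_right hq⟩

theorem IsProjLine.eq_span_pair {k : Submodule ℂ (Fin 4 → ℂ)} (hk : IsProjLine k)
    {u v : Fin 4 → ℂ} (huv : LinearIndependent ℂ ![u, v]) (hu : u ∈ k) (hv : v ∈ k) :
    k = Submodule.span ℂ {u, v} := by
  refine (Submodule.eq_of_le_of_finrank_eq ?_ ?_).symm
  · rw [Submodule.span_le]
    rintro x (rfl | rfl) <;> assumption
  · have := finrank_span_eq_card huv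
    rw [Matrix.range_cons_cons_empty, Fintype.card_fin] at this
    exact this.trans hk.symm

/-- A line that meets two skew lines in the points `p` and `q` is spanned by these. -/
theorem IsProjLine.eq_span_of_inf_eq {m k k' : Submodule ℂ (Fin 4 → ℂ)} (hm : IsProjLine m)
    (hkk' : SkewLines k k') {p q : Fin 4 → ℂ} (hp : p ≠ 0) (hq : q ≠ 0)
    (hpk : m ⊓ k = Submodule.span ℂ {p}) (hqk : m ⊓ k' = Submodule.span ℂ {q}) :
    m = Submodule.span ℂ {p, q} := by
  have hp' : p ∈ m ⊓ k := hpk ▸ Submodule.mem_span_singleton_self p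
  have hq' : q ∈ m ⊓ k' := hqk ▸ Submodule.mem_span_singleton_self q
  exact hm.eq_span_pair (hkk'.linearIndependent hp hq hp'.2 hq'.2) hp'.1 hq'.1

/-- Three pairwise skew lines meet the line `k` in the points `∞`, `0`, `1` of a suitable
inhomogeneous coordinate. -/
theorem exists_coordinate {k c a₁ a₂ : Submodule ℂ (Fin 4 → ℂ)} (hk : IsProjLine k)
    (hc : IsProjLine c) (ha₁ : IsProjLine a₁) (ha₂ : IsProjLine a₂) (hck : LinesMeet c k)
    (h₁k : LinesMeet a₁ k) (h₂k : LinesMeet a₂ k) (h1c : SkewLines a₁ c) (h2c : SkewLines a₂ c)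
    (h12 : SkewLines a₁ a₂) :
    ∃ u v, LinearIndependent ℂ ![u, v] ∧ k = Submodule.span ℂ {u, v} ∧
      c ⊓ k = Submodule.span ℂ {u} ∧ a₁ ⊓ k = Submodule.span ℂ {v} ∧
      a₂ ⊓ k = Submodule.span ℂ {u + v} := by
  obtain ⟨p, hp0, hp⟩ := hck.exists_inf_eq_span hc hk h₁k (by rw [SkewLines, inf_comm]; exact h1c)
  obtain ⟨q, hq0, hq⟩ := h₁k.exists_inf_eq_span ha₁ hk hck h1c
  obtain ⟨r, hr0, hr⟩ := h₂k.exists_inf_eq_span ha₂ hk hck h2c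
  have hpm : p ∈ c ⊓ k := hp ▸ Submodule.mem_span_singleton_self p
  have hqm : q ∈ a₁ ⊓ k := hq ▸ Submodule.mem_span_singleton_self q
  have hrm : r ∈ a₂ ⊓ k := hr ▸ Submodule.mem_span_singleton_self r
  have hqp := h1c.linearIndependent hq0 hp0 hqm.1 hpm.1
  have hrp := LinearIndependent.pair_iff.1 (h2c.linearIndependent hr0 hp0 hrm.1 hpm.1)
  have hqr := LinearIndependent.pair_iff.1 (h12.linearIndependent hq0 hr0 hqm.1 hrm.1)
  have hk2 := hk.eq_span_pair hqp hqm.2 hpm.2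
  obtain ⟨b, a, rfl⟩ := Submodule.mem_span_pair.1 (hk2 ▸ hrm.2)
  have ha : a ≠ 0 := by
    rintro rfl
    simpa using (hqr (-b) 1 (by module)).2
  have hb : b ≠ 0 := by
    rintro rfl
    simpa using (hrp 1 (-a) (by module)).1
  have hind : LinearIndependent ℂ ![a • p, b • q] := by
    rw [LinearIndependent.pair_iff] at hqp ⊢
    intro s t hst
    have := hqp (t * b) (s * a) (by rw [← hst]; module)
    simpa [ha, hb, and_comm] using this
  refine ⟨a • p, b • q, hind, ?_, ?_, ?_, ?_⟩
  · exact hk.eq_span_pair hind (k.smul_mem a hpm.2) (k.smul_mem b hqm.2)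
  · rw [hp, Submodule.span_singleton_smul_eq (IsUnit.mk0 a ha)]
  · rw [hq, Submodule.span_singleton_smul_eq (IsUnit.mk0 b hb)]
  · rw [hr, add_comm]

/-- The point in which a fourth line meets `k`, in terms of the cross ratio. -/
theorem exists_isCrossRatio {k c a₁ a₂ m : Submodule ℂ (Fin 4 → ℂ)} (hk : IsProjLine k)
    (hm : IsProjLine m) (hck : LinesMeet c k) (hmk : LinesMeet m k) (hmc : SkewLines m c)
    (hm1 : SkewLines m a₁) (hm2 : SkewLines m a₂) {u v : Fin 4 → ℂ}
    (huv : LinearIndependent ℂ ![u, v]) (hu : c ⊓ k = Submodule.span ℂ {u})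
    (hv : a₁ ⊓ k = Submodule.span ℂ {v}) (huv' : a₂ ⊓ k = Submodule.span ℂ {u + v}) :
    ∃ t, IsCrossRatio k c a₁ a₂ m t ∧ m ⊓ k = Submodule.span ℂ {t • u + v} ∧ t ≠ 0 ∧ t ≠ 1 := by
  obtain ⟨p, hp0, hp⟩ := hmk.exists_inf_eq_span hm hk hck hmc
  have hum : u ∈ c ⊓ k := hu ▸ Submodule.mem_span_singleton_self u
  have hvm : v ∈ a₁ ⊓ k := hv ▸ Submodule.mem_span_singleton_self v
  have huvm : u + v ∈ a₂ ⊓ k := huv' ▸ Submodule.mem_span_singleton_self _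
  have hpm : p ∈ m ⊓ k := hp ▸ Submodule.mem_span_singleton_self p
  have hu0 : u ≠ 0 := by simpa using huv.ne_zero 0
  have hv0 : v ≠ 0 := by simpa using huv.ne_zero 1
  have huv0 : u + v ≠ 0 := fun h0 => by
    simpa using (LinearIndependent.pair_iff.1 huv 1 1 (by rw [← h0]; module)).1
  obtain ⟨a, b, rfl⟩ := Submodule.mem_span_pair.1 (hk.eq_span_pair huv hum.2 hvm.2 ▸ hpm.2)
  have i1 := LinearIndependent.pair_iff.1 (hmc.linearIndependent hp0 hu0 hpm.1 hum.1)
  have i2 := LinearIndependent.pair_iff.1 (hm1.linearIndependent hp0 hv0 hpm.1 hvm.1)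
  have i3 := LinearIndependent.pair_iff.1 (hm2.linearIndependent hp0 huv0 hpm.1 huvm.1)
  have hb : b ≠ 0 := by
    rintro rfl
    simpa using (i1 1 (-a) (by module)).1
  have ht : m ⊓ k = Submodule.span ℂ {(a / b) • u + v} := by
    rw [hp, ← Submodule.span_singleton_smul_eq (IsUnit.mk0 b hb) ((a / b) • u + v), smul_add,
      smul_smul, mul_div_cancel₀ _ hb]
  refine ⟨a / b, ⟨u, v, huv, hu, hv, huv', ht⟩, ht, ?_, ?_⟩
  · intro h0
    have ha : a = 0 := by simpa [hb] using h0
    subst ha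
    simpa using (i2 1 (-b) (by module)).1
  · intro h1
    have ha : a = b := by rwa [div_eq_one_iff_eq hb] at h1
    subst ha
    simpa using (i3 1 (-a) (by module)).1

namespace SevenLines

theorem exists_isAdapted (L : SevenLines) :
    ∃ e : (Fin 4 → ℂ) ≃ₗ[ℂ] (Fin 4 → ℂ), L.IsAdapted e := by
  obtain ⟨u, v, huv, hk, hu, hv, hw⟩ := exists_coordinate L.isProjLine_b₅ L.isProjLine_c₅₆
    (L.isProjLine_a 0) (L.isProjLine_a 1) L.meet_c₅₆_b₅ (L.meet_a_b₅ 0) (L.meet_a_b₅ 1)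
    (L.skew_a_c₅₆ 0) (L.skew_a_c₅₆ 1) (L.skew_a 0 1 (by decide))
  obtain ⟨u', v', huv', hk', hu', hv', hw'⟩ := exists_coordinate L.isProjLine_b₆ L.isProjLine_c₅₆
    (L.isProjLine_a 0) (L.isProjLine_a 1) L.meet_c₅₆_b₆ (L.meet_a_b₆ 0) (L.meet_a_b₆ 1)
    (L.skew_a_c₅₆ 0) (L.skew_a_c₅₆ 1) (L.skew_a 0 1 (by decide))
  have hi : LinearIndependent ℂ ![u', u, v', v] := by
    rw [linearIndependent_four_iff]
    intro a b c d h
    have h5 : b • u + d • v ∈ L.b₅ := hk ▸ Submodule.mem_span_pair.2 ⟨b, d, rfl⟩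
    have h6 : b • u + d • v ∈ L.b₆ := hk' ▸ Submodule.mem_span_pair.2 ⟨-a, -c, by
      rw [← sub_eq_zero, ← neg_eq_zero, ← h]; module⟩
    have h0 : b • u + d • v ∈ L.b₅ ⊓ L.b₆ := ⟨h5, h6⟩
    rw [L.skew_b, Submodule.mem_bot] at h0
    have hbd := LinearIndependent.pair_iff.1 huv b d h0
    have hac := LinearIndependent.pair_iff.1 huv' a c (by
      rw [← sub_zero (_ + _), ← h0, ← sub_eq_zero, ← h, hbd.1, hbd.2]; module)
    exact ⟨hac.1, hbd.1, hac.2, hbd.2⟩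
  let B := basisOfLinearIndependentOfCardEqFinrank hi (by simp)
  have hB : ∀ i, B i = ![u', u, v', v] i := fun i => by
    simp [B, coe_basisOfLinearIndependentOfCardEqFinrank]
  let e := B.equivFun
  have he : ∀ a b c d : ℂ, e (a • u' + b • u + c • v' + d • v) = ![a, b, c, d] := by
    intro a b c d
    rw [← LinearEquiv.eq_symm_apply, Module.Basis.equivFun_symm_apply, Fin.sum_univ_four]
    simp [hB]
  have hx : ∀ x, x = e x 0 • u' + e x 1 • u + e x 2 • v' + e x 3 • v := by
    intro x
    have := B.sum_equivFun x
    rw [Fin.sum_univ_four] at this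
    simp only [hB] at this
    exact this.symm
  have h5 : ∀ a b : ℂ, e (a • u + b • v) = ![0, a, 0, b] := fun a b => by
    rw [← he]; congr 1; module
  have h6 : ∀ a b : ℂ, e (a • u' + b • v') = ![a, 0, b, 0] := fun a b => by
    rw [← he]; congr 1; module
  refine ⟨e, ⟨fun x => ⟨fun hxb => ?_, fun hxe => ?_⟩, fun x => ⟨fun hxb => ?_, fun hxe => ?_⟩,
    fun x hxm => ?_, fun x hxm => ?_, fun x hxm => ?_, fun x hxm => ?_, fun x hxm => ?_,
    fun x hxm => ?_⟩⟩
  · obtain ⟨a, b, rfl⟩ := Submodule.mem_span_pair.1 (hk ▸ hxb)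
    simp [h5]
  · rw [hk, hx x, hxe.1, hxe.2]
    exact Submodule.mem_span_pair.2 ⟨e x 1, e x 3, by module⟩
  · obtain ⟨a, b, rfl⟩ := Submodule.mem_span_pair.1 (hk' ▸ hxb)
    simp [h6]
  · rw [hk', hx x, hxe.1, hxe.2]
    exact Submodule.mem_span_pair.2 ⟨e x 0, e x 2, by module⟩
  · obtain ⟨a, rfl⟩ := Submodule.mem_span_singleton.1 (hv ▸ hxm)
    have := h5 0 a
    rw [zero_smul, zero_add] at this
    simp [this]
  · obtain ⟨a, rfl⟩ := Submodule.mem_span_singleton.1 (hw ▸ hxm)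
    rw [smul_add, h5]
    simp
  · obtain ⟨a, rfl⟩ := Submodule.mem_span_singleton.1 (hu ▸ hxm)
    have := h5 a 0
    rw [zero_smul, add_zero] at this
    simp [this]
  · obtain ⟨a, rfl⟩ := Submodule.mem_span_singleton.1 (hv' ▸ hxm)
    have := h6 0 a
    rw [zero_smul, zero_add] at this
    simp [this]
  · obtain ⟨a, rfl⟩ := Submodule.mem_span_singleton.1 (hw' ▸ hxm)
    rw [smul_add, h6]
    simp
  · obtain ⟨a, rfl⟩ := Submodule.mem_span_singleton.1 (hu' ▸ hxm)
    have := h6 a 0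
    rw [zero_smul, add_zero] at this
    simp [this]

end SevenLines

/-! ### Adapted coordinates -/

namespace SevenLines

/-- In adapted coordinates `e`, with coordinate points `E₀, …, E₃`, the seven lines are determined
by the cross ratios. -/
theorem IsAdapted.lines_eq {L : SevenLines} {e : (Fin 4 → ℂ) ≃ₗ[ℂ] (Fin 4 → ℂ)}
    (he : L.IsAdapted e) {E : Fin 4 → Fin 4 → ℂ} (hE : ∀ i, E i = e.symm (Pi.single i 1)) :
    (L.b₅ = Submodule.span ℂ {E 1, E 3} ∧ L.b₆ = Submodule.span ℂ {E 0, E 2} ∧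
      L.c₅₆ = Submodule.span ℂ {E 1, E 0} ∧ L.a 0 = Submodule.span ℂ {E 3, E 2} ∧
      L.a 1 = Submodule.span ℂ {E 1 + E 3, E 0 + E 2} ∧
      L.a 2 = Submodule.span ℂ {L.alpha • E 1 + E 3, L.alpha' • E 0 + E 2} ∧
      L.a 3 = Submodule.span ℂ {L.beta • E 1 + E 3, L.beta' • E 0 + E 2}) ∧
    (L.alpha ≠ 0 ∧ L.alpha ≠ 1 ∧ L.alpha' ≠ 0 ∧ L.alpha' ≠ 1 ∧
      L.beta ≠ 0 ∧ L.beta ≠ 1 ∧ L.beta' ≠ 0 ∧ L.beta' ≠ 1 ∧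
      L.alpha ≠ L.beta ∧ L.alpha' ≠ L.beta') := by
  have hx : ∀ x, x = e x 0 • E 0 + e x 1 • E 1 + e x 2 • E 2 + e x 3 • E 3 := by
    intro x
    apply e.injective
    simp only [map_add, map_smul, hE, LinearEquiv.apply_symm_apply]
    conv_lhs => rw [pi_eq_sum_univ' (e x), Fin.sum_univ_four]
  have hEi : ∀ i j, e (E i) j = if j = i then 1 else 0 := by
    intro i j
    rw [hE, LinearEquiv.apply_symm_apply, Pi.single_apply]
  have hE5 : ∀ i, i = 1 ∨ i = 3 → E i ∈ L.b₅ := by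
    rintro i (rfl | rfl) <;> simp [he.b₅_eq, hEi]
  have hE6 : ∀ i, i = 0 ∨ i = 2 → E i ∈ L.b₆ := by
    rintro i (rfl | rfl) <;> simp [he.b₆_eq, hEi]
  have hi : ∀ i j, i ≠ j → LinearIndependent ℂ ![E i, E j] := by
    intro i j hij
    rw [LinearIndependent.pair_iff]
    intro a b hab
    have h1 := congrArg (fun y => e y i) hab
    have h2 := congrArg (fun y => e y j) hab
    simp [hEi, hij, hij.symm] at h1 h2
    exact ⟨h1, h2⟩
  have hb5 := L.isProjLine_b₅.eq_span_pair (hi 1 3 (by decide)) (hE5 1 (by simp))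
    (hE5 3 (by simp))
  have hb6 := L.isProjLine_b₆.eq_span_pair (hi 0 2 (by decide)) (hE6 0 (by simp))
    (hE6 2 (by simp))
  have hswap : ∀ {m n}, SkewLines m n → SkewLines n m := fun h => by
    rw [SkewLines, inf_comm]; exact h
  have s01 := L.skew_a 0 1 (by decide)
  have pt : ∀ {m m' k : Submodule ℂ (Fin 4 → ℂ)} {y : Fin 4 → ℂ}, IsProjLine m → IsProjLine k →
      LinesMeet m k → LinesMeet m' k → SkewLines m m' →
      (∀ x ∈ m ⊓ k, x ∈ Submodule.span ℂ {y}) → m ⊓ k = Submodule.span ℂ {y} := by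
    intro m m' k y hm hk hmk hm'k hmm' hy
    obtain ⟨p, hp0, hp⟩ := hmk.exists_inf_eq_span hm hk hm'k hmm'
    exact hp.trans (Submodule.span_singleton_eq_of_mem hp0
      (hy p (hp ▸ Submodule.mem_span_singleton_self p)))
  have h5c : L.c₅₆ ⊓ L.b₅ = Submodule.span ℂ {E 1} :=
    pt L.isProjLine_c₅₆ L.isProjLine_b₅ L.meet_c₅₆_b₅ (L.meet_a_b₅ 0) (hswap (L.skew_a_c₅₆ 0))
      fun x hxm => Submodule.mem_span_singleton.2 ⟨e x 1, by
        have h := (he.b₅_eq x).1 hxm.2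
        conv_rhs => rw [hx x, h.1, h.2, he.c₅₆_b₅ x hxm]
        module⟩
  have h50 : L.a 0 ⊓ L.b₅ = Submodule.span ℂ {E 3} :=
    pt (L.isProjLine_a 0) L.isProjLine_b₅ (L.meet_a_b₅ 0) (L.meet_a_b₅ 1) s01
      fun x hxm => Submodule.mem_span_singleton.2 ⟨e x 3, by
        have h := (he.b₅_eq x).1 hxm.2
        conv_rhs => rw [hx x, h.1, h.2, he.a₁_b₅ x hxm]
        module⟩
  have h51 : L.a 1 ⊓ L.b₅ = Submodule.span ℂ {E 1 + E 3} :=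
    pt (L.isProjLine_a 1) L.isProjLine_b₅ (L.meet_a_b₅ 1) (L.meet_a_b₅ 0) (hswap s01)
      fun x hxm => Submodule.mem_span_singleton.2 ⟨e x 3, by
        have h := (he.b₅_eq x).1 hxm.2
        conv_rhs => rw [hx x, h.1, h.2, he.a₂_b₅ x hxm]
        module⟩
  have h6c : L.c₅₆ ⊓ L.b₆ = Submodule.span ℂ {E 0} :=
    pt L.isProjLine_c₅₆ L.isProjLine_b₆ L.meet_c₅₆_b₆ (L.meet_a_b₆ 0) (hswap (L.skew_a_c₅₆ 0))
      fun x hxm => Submodule.mem_span_singleton.2 ⟨e x 0, by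
        have h := (he.b₆_eq x).1 hxm.2
        conv_rhs => rw [hx x, h.1, h.2, he.c₅₆_b₆ x hxm]
        module⟩
  have h60 : L.a 0 ⊓ L.b₆ = Submodule.span ℂ {E 2} :=
    pt (L.isProjLine_a 0) L.isProjLine_b₆ (L.meet_a_b₆ 0) (L.meet_a_b₆ 1) s01
      fun x hxm => Submodule.mem_span_singleton.2 ⟨e x 2, by
        have h := (he.b₆_eq x).1 hxm.2
        conv_rhs => rw [hx x, h.1, h.2, he.a₁_b₆ x hxm]
        module⟩
  have h61 : L.a 1 ⊓ L.b₆ = Submodule.span ℂ {E 0 + E 2} :=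
    pt (L.isProjLine_a 1) L.isProjLine_b₆ (L.meet_a_b₆ 1) (L.meet_a_b₆ 0) (hswap s01)
      fun x hxm => Submodule.mem_span_singleton.2 ⟨e x 2, by
        have h := (he.b₆_eq x).1 hxm.2
        conv_rhs => rw [hx x, h.1, h.2, he.a₂_b₆ x hxm]
        module⟩
  have cr5 := fun (i : Fin 4) (hi0 : i ≠ 0) (hi1 : i ≠ 1) =>
    exists_isCrossRatio L.isProjLine_b₅ (L.isProjLine_a i) L.meet_c₅₆_b₅ (L.meet_a_b₅ i)
      (L.skew_a_c₅₆ i) (L.skew_a i 0 hi0) (L.skew_a i 1 hi1) (hi 1 3 (by decide)) h5c h50 h51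
  have cr6 := fun (i : Fin 4) (hi0 : i ≠ 0) (hi1 : i ≠ 1) =>
    exists_isCrossRatio L.isProjLine_b₆ (L.isProjLine_a i) L.meet_c₅₆_b₆ (L.meet_a_b₆ i)
      (L.skew_a_c₅₆ i) (L.skew_a i 0 hi0) (L.skew_a i 1 hi1) (hi 0 2 (by decide)) h6c h60 h61
  obtain ⟨α, hα, hαs, hα0, hα1⟩ := cr5 2 (by decide) (by decide)
  obtain ⟨α', hα', hαs', hα0', hα1'⟩ := cr6 2 (by decide) (by decide)
  obtain ⟨β, hβ, hβs, hβ0, hβ1⟩ := cr5 3 (by decide) (by decide)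
  obtain ⟨β', hβ', hβs', hβ0', hβ1'⟩ := cr6 3 (by decide) (by decide)
  have eα : L.alpha = α := hα.crossRatio_eq
  have eα' : L.alpha' = α' := hα'.crossRatio_eq
  have eβ : L.beta = β := hβ.crossRatio_eq
  have eβ' : L.beta' = β' := hβ'.crossRatio_eq
  rw [eα, eα', eβ, eβ']
  have h0 : ∀ i, E i ≠ 0 := fun i hi0 => by
    have := hEi i i
    rw [hi0] at this
    simp at this
  have hne : ∀ i j, i ≠ j → ∀ t : ℂ, t • E i + E j ≠ 0 := fun i j hij t h => by
    simpa using (LinearIndependent.pair_iff.1 (hi i j hij) t 1 (by rw [one_smul]; exact h)).2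
  have hne1 : ∀ i j, i ≠ j → E i + E j ≠ 0 := fun i j hij h =>
    hne i j hij 1 (by rw [one_smul]; exact h)
  -- distinct lines meet a line in distinct points
  have hdist : ∀ {k : Submodule ℂ (Fin 4 → ℂ)} {p q : Fin 4 → ℂ}, p ≠ 0 →
      L.a 2 ⊓ k = Submodule.span ℂ {p} → L.a 3 ⊓ k = Submodule.span ℂ {q} → p ≠ q := by
    rintro k p q hp h2 h3 rfl
    have m2 : p ∈ L.a 2 ⊓ k := h2 ▸ Submodule.mem_span_singleton_self p
    have m3 : p ∈ L.a 3 ⊓ k := h3 ▸ Submodule.mem_span_singleton_self p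
    have : p ∈ L.a 2 ⊓ L.a 3 := ⟨m2.1, m3.1⟩
    rw [L.skew_a 2 3 (by decide)] at this
    exact hp (by simpa using this)
  refine ⟨⟨hb5, hb6, ?_, ?_, ?_, ?_, ?_⟩, hα0, hα1, hα0', hα1', hβ0, hβ1, hβ0', hβ1', ?_, ?_⟩
  · exact L.isProjLine_c₅₆.eq_span_of_inf_eq L.skew_b (h0 _) (h0 _) h5c h6c
  · exact (L.isProjLine_a 0).eq_span_of_inf_eq L.skew_b (h0 _) (h0 _) h50 h60
  · exact (L.isProjLine_a 1).eq_span_of_inf_eq L.skew_b (hne1 _ _ (by decide))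
      (hne1 _ _ (by decide)) h51 h61
  · exact (L.isProjLine_a 2).eq_span_of_inf_eq L.skew_b (hne _ _ (by decide) _)
      (hne _ _ (by decide) _) hαs hαs'
  · exact (L.isProjLine_a 3).eq_span_of_inf_eq L.skew_b (hne _ _ (by decide) _)
      (hne _ _ (by decide) _) hβs hβs'
  · rintro rfl
    exact hdist (hne 1 3 (by decide) _) hαs hβs rfl
  · rintro rfl
    exact hdist (hne 0 2 (by decide) _) hαs' hβs' rfl

end SevenLines

/-! ### The explicit cubics -/

/-- For a cubic form, the second difference at `v` with step `x` is twice the differential at `x`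
applied to `v`; so it does not vanish for all `v` if the form is non-singular. -/
theorem IsNonsingularCubic.exists_second_difference_ne_zero {F : MvPolynomial (Fin 4) ℂ}
    (hF : IsNonsingularCubic F) {x : Fin 4 → ℂ} (hx : x ≠ 0) :
    ∃ v, MvPolynomial.eval (v + x) F + MvPolynomial.eval (v - x) F
      - 2 * MvPolynomial.eval v F ≠ 0 := by
  obtain ⟨φ, hφ, h1, h2⟩ := hF.1.2.exists_trilinear
  obtain ⟨v, hv⟩ := hF.isNonsingularForm h1 h2 x hx
  refine ⟨v, ?_⟩
  rw [h1, h1, h1, ← hφ.six_mul_apply]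
  exact mul_ne_zero (by norm_num) hv

theorem containsLine_span_pair_iff {F : MvPolynomial (Fin 4) ℂ} {p q : Fin 4 → ℂ} :
    ContainsLine F (Submodule.span ℂ {p, q}) ↔
      ∀ a b : ℂ, MvPolynomial.eval (a • p + b • q) F = 0 := by
  constructor
  · intro h a b
    exact h _ (Submodule.mem_span_pair.2 ⟨a, b, rfl⟩)
  · rintro h x hx
    obtain ⟨a, b, rfl⟩ := Submodule.mem_span_pair.1 hx
    exact h a b

theorem eval_explicitCubicOne (p p' q q' : ℂ) (z : Fin 4 → ℂ) :
    MvPolynomial.eval z (explicitCubicOne p p' q q') =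
      (-p * q * q' + q ^ 2 * q' + q * p' * q' - q ^ 2 * p' * q' - q * q' ^ 2
        + p * q * q' ^ 2) * (z 2 * z 1 ^ 2)
      + (p * q * p' - q ^ 2 * p' - p * p' * q' + q ^ 2 * p' * q' + p * q' ^ 2
        - p * q * q' ^ 2) * (z 0 * z 1 * z 3)
      + (-q * p' + q ^ 2 * p' + p * q' - q ^ 2 * q' - p * q' ^ 2 + q * q' ^ 2)
        * (z 2 * z 1 * z 3)
      + (q * p' - p * q * p' - p * q' + p * q * q' + p * p' * q' - q * p' * q')
        * (z 0 * z 3 ^ 2) := by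
  simp only [explicitCubicOne, map_add, map_mul, map_pow, MvPolynomial.eval_C,
    MvPolynomial.eval_X]
  ring

theorem eval_explicitCubicTwo (p p' q q' : ℂ) (z : Fin 4 → ℂ) :
    MvPolynomial.eval z (explicitCubicTwo p p' q q') =
      (-q * p' + p * q * p' + p * q' - p * q * q' - p * p' * q' + q * p' * q')
        * (z 1 * z 2 ^ 2)
      + (q * p' ^ 2 - p * q * p' ^ 2 - p ^ 2 * q' + p * q * q' + p ^ 2 * p' * q'
        - q * p' * q') * (z 1 * z 0 * z 2)
      + (-p ^ 2 * p' + q * p' + p * p' ^ 2 - q * p' ^ 2 - p * q' + p ^ 2 * q')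
        * (z 3 * z 0 * z 2)
      + (p ^ 2 * p' - p * q * p' - p * p' ^ 2 + p * q * p' ^ 2 + p * p' * q'
        - p ^ 2 * p' * q') * (z 3 * z 0 ^ 2) := by
  simp only [explicitCubicTwo, map_add, map_mul, map_pow, MvPolynomial.eval_C,
    MvPolynomial.eval_X]
  ring

open MvPolynomial in
theorem explicitCubicOne_isHomogeneous (p p' q q' : ℂ) :
    (explicitCubicOne p p' q q').IsHomogeneous 3 := by
  have hC : ∀ (c : ℂ) (i : Fin 4), (C c * X i : MvPolynomial (Fin 4) ℂ).IsHomogeneous 1 :=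
    fun c i => by simpa using (isHomogeneous_C (Fin 4) c).mul (isHomogeneous_X ℂ i)
  have h1 : (X 1 ^ 2 : MvPolynomial (Fin 4) ℂ).IsHomogeneous 2 := by
    simpa using (isHomogeneous_X ℂ 1).pow 2
  have h3 : (X 3 ^ 2 : MvPolynomial (Fin 4) ℂ).IsHomogeneous 2 := by
    simpa using (isHomogeneous_X ℂ 3).pow 2
  exact (((hC _ 2).mul h1).add (((hC _ 0).add (hC _ 2)).mul
    ((isHomogeneous_X ℂ 1).mul (isHomogeneous_X ℂ 3)))).add ((hC _ 0).mul h3)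

open MvPolynomial in
theorem explicitCubicTwo_isHomogeneous (p p' q q' : ℂ) :
    (explicitCubicTwo p p' q q').IsHomogeneous 3 := by
  have hC : ∀ (c : ℂ) (i : Fin 4), (C c * X i : MvPolynomial (Fin 4) ℂ).IsHomogeneous 1 :=
    fun c i => by simpa using (isHomogeneous_C (Fin 4) c).mul (isHomogeneous_X ℂ i)
  have h0 : (X 0 ^ 2 : MvPolynomial (Fin 4) ℂ).IsHomogeneous 2 := by
    simpa using (isHomogeneous_X ℂ 0).pow 2
  have h2 : (X 2 ^ 2 : MvPolynomial (Fin 4) ℂ).IsHomogeneous 2 := by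
    simpa using (isHomogeneous_X ℂ 2).pow 2
  exact (((hC _ 1).mul h2).add (((hC _ 1).add (hC _ 3)).mul
    ((isHomogeneous_X ℂ 0).mul (isHomogeneous_X ℂ 2)))).add ((hC _ 3).mul h0)

theorem pullbackForm_isHomogeneous (e : (Fin 4 → ℂ) ≃ₗ[ℂ] (Fin 4 → ℂ))
    {F : MvPolynomial (Fin 4) ℂ} {n : ℕ} (hF : F.IsHomogeneous n) :
    (pullbackForm e F).IsHomogeneous n := by
  have := hF.aeval (n := 1)
    (fun i => ∑ j, MvPolynomial.C (e (Pi.single j 1) i) * MvPolynomial.X j)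
    fun i => MvPolynomial.IsHomogeneous.sum _ _ _ fun j _ => by
      simpa using (MvPolynomial.isHomogeneous_C (Fin 4) (e (Pi.single j 1) i)).mul
        (MvPolynomial.isHomogeneous_X ℂ j)
  rwa [one_mul] at this

/-- If four coefficients satisfy the three linear conditions that a form of bidegree `(1, 2)`
through `(0, 0)` and `(∞, ∞)` vanishes at three further points, then they are proportional to the
coefficients of the first explicit cubic, which are the maximal minors of these conditions. -/
theorem exists_eq_mul_coeff_one {p p' q q' m₀ m₁ m₂ m₃ : ℂ} (h₁ : m₀ + m₁ + m₂ + m₃ = 0)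
    (h₂ : p * m₀ + q * m₁ + p * q * m₂ + q ^ 2 * m₃ = 0)
    (h₃ : p' * m₀ + q' * m₁ + p' * q' * m₂ + q' ^ 2 * m₃ = 0)
    (hne : -p * q * q' + q ^ 2 * q' + q * p' * q' - q ^ 2 * p' * q' - q * q' ^ 2
        + p * q * q' ^ 2 ≠ 0 ∨
      q * p' - p * q * p' - p * q' + p * q * q' + p * p' * q' - q * p' * q' ≠ 0) :
    ∃ k, m₀ = k * (-p * q * q' + q ^ 2 * q' + q * p' * q' - q ^ 2 * p' * q' - q * q' ^ 2
        + p * q * q' ^ 2) ∧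
      m₁ = k * (p * q * p' - q ^ 2 * p' - p * p' * q' + q ^ 2 * p' * q' + p * q' ^ 2
        - p * q * q' ^ 2) ∧
      m₂ = k * (-q * p' + q ^ 2 * p' + p * q' - q ^ 2 * q' - p * q' ^ 2 + q * q' ^ 2) ∧
      m₃ = k * (q * p' - p * q * p' - p * q' + p * q * q' + p * p' * q' - q * p' * q') := by
  set c₀ := -p * q * q' + q ^ 2 * q' + q * p' * q' - q ^ 2 * p' * q' - q * q' ^ 2
    + p * q * q' ^ 2 with hc₀
  set c₁ := p * q * p' - q ^ 2 * p' - p * p' * q' + q ^ 2 * p' * q' + p * q' ^ 2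
    - p * q * q' ^ 2 with hc₁
  set c₂ := -q * p' + q ^ 2 * p' + p * q' - q ^ 2 * q' - p * q' ^ 2 + q * q' ^ 2 with hc₂
  set c₃ := q * p' - p * q * p' - p * q' + p * q * q' + p * p' * q' - q * p' * q' with hc₃
  have e01 : m₀ * c₁ - m₁ * c₀ = 0 := by
    rw [hc₀, hc₁]
    linear_combination -(p * q * q' ^ 2 - q ^ 2 * (p' * q')) * h₁
      + (q' ^ 2 - p' * q') * h₂ - (q ^ 2 - p * q) * h₃
  have e02 : m₀ * c₂ - m₂ * c₀ = 0 := by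
    rw [hc₀, hc₂]
    linear_combination (q * q' ^ 2 - q ^ 2 * q') * h₁ - (q' ^ 2 - q') * h₂ + (q ^ 2 - q) * h₃
  have e03 : m₀ * c₃ - m₃ * c₀ = 0 := by
    rw [hc₀, hc₃]
    linear_combination -(q * (p' * q') - p * q * q') * h₁ + (p' * q' - q') * h₂
      - (p * q - q) * h₃
  have e13 : m₁ * c₃ - m₃ * c₁ = 0 := by
    rw [hc₁, hc₃]
    linear_combination (p * (p' * q') - p * q * p') * h₁ - (p' * q' - p') * h₂
      + (p * q - p) * h₃
  have e23 : m₂ * c₃ - m₃ * c₂ = 0 := by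
    rw [hc₂, hc₃]
    linear_combination -(p * q' - q * p') * h₁ + (q' - p') * h₂ - (q - p) * h₃
  clear_value c₀ c₁ c₂ c₃
  rcases hne with h | h
  · refine ⟨m₀ / c₀, ?_, ?_, ?_, ?_⟩ <;> field_simp
    · linear_combination -e01
    · linear_combination -e02
    · linear_combination -e03
  · refine ⟨m₃ / c₃, ?_, ?_, ?_, ?_⟩ <;> field_simp
    · linear_combination e03
    · linear_combination e13
    · linear_combination e23

/-- The counterpart of `exists_eq_mul_coeff_one` for the bidegree `(2, 1)`. -/
theorem exists_eq_mul_coeff_two {p p' q q' m₀ m₁ m₂ m₃ : ℂ} (h₁ : m₀ + m₁ + m₂ + m₃ = 0)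
    (h₂ : p ^ 2 * m₀ + p * m₁ + p * q * m₂ + q * m₃ = 0)
    (h₃ : p' ^ 2 * m₀ + p' * m₁ + p' * q' * m₂ + q' * m₃ = 0)
    (hne : -q * p' + p * q * p' + p * q' - p * q * q' - p * p' * q' + q * p' * q' ≠ 0 ∨
      p ^ 2 * p' - p * q * p' - p * p' ^ 2 + p * q * p' ^ 2 + p * p' * q'
        - p ^ 2 * p' * q' ≠ 0) :
    ∃ k, m₀ = k * (-q * p' + p * q * p' + p * q' - p * q * q' - p * p' * q' + q * p' * q') ∧
      m₁ = k * (q * p' ^ 2 - p * q * p' ^ 2 - p ^ 2 * q' + p * q * q' + p ^ 2 * p' * q'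
        - q * p' * q') ∧
      m₂ = k * (-p ^ 2 * p' + q * p' + p * p' ^ 2 - q * p' ^ 2 - p * q' + p ^ 2 * q') ∧
      m₃ = k * (p ^ 2 * p' - p * q * p' - p * p' ^ 2 + p * q * p' ^ 2 + p * p' * q'
        - p ^ 2 * p' * q') := by
  set c₀ := -q * p' + p * q * p' + p * q' - p * q * q' - p * p' * q' + q * p' * q' with hc₀
  set c₁ := q * p' ^ 2 - p * q * p' ^ 2 - p ^ 2 * q' + p * q * q' + p ^ 2 * p' * q'
    - q * p' * q' with hc₁
  set c₂ := -p ^ 2 * p' + q * p' + p * p' ^ 2 - q * p' ^ 2 - p * q' + p ^ 2 * q' with hc₂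
  set c₃ := p ^ 2 * p' - p * q * p' - p * p' ^ 2 + p * q * p' ^ 2 + p * p' * q'
    - p ^ 2 * p' * q' with hc₃
  have e01 : m₀ * c₁ - m₁ * c₀ = 0 := by
    rw [hc₀, hc₁]
    linear_combination (p * q * q' - q * (p' * q')) * h₁
      - (q' - p' * q') * h₂ + (q - p * q) * h₃
  have e02 : m₀ * c₂ - m₂ * c₀ = 0 := by
    rw [hc₀, hc₂]
    linear_combination -(p * q' - q * p') * h₁ + (q' - p') * h₂ - (q - p) * h₃
  have e03 : m₀ * c₃ - m₃ * c₀ = 0 := by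
    rw [hc₀, hc₃]
    linear_combination (p * (p' * q') - p * q * p') * h₁ - (p' * q' - p') * h₂
      + (p * q - p) * h₃
  have e13 : m₁ * c₃ - m₃ * c₁ = 0 := by
    rw [hc₁, hc₃]
    linear_combination -(p ^ 2 * (p' * q') - p * q * p' ^ 2) * h₁ + (p' * q' - p' ^ 2) * h₂
      - (p * q - p ^ 2) * h₃
  have e23 : m₂ * c₃ - m₃ * c₂ = 0 := by
    rw [hc₂, hc₃]
    linear_combination (p ^ 2 * p' - p * p' ^ 2) * h₁ - (p' - p' ^ 2) * h₂ + (p - p ^ 2) * h₃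
  clear_value c₀ c₁ c₂ c₃
  rcases hne with h | h
  · refine ⟨m₀ / c₀, ?_, ?_, ?_, ?_⟩ <;> field_simp
    · linear_combination -e01
    · linear_combination -e02
    · linear_combination -e03
  · refine ⟨m₃ / c₃, ?_, ?_, ?_, ?_⟩ <;> field_simp
    · linear_combination e03
    · linear_combination e13
    · linear_combination e23

/-- If the points `(1, 1)`, `(p, q)`, `(p', q')` are collinear and the last coefficient of the
first explicit cubic vanishes, then the line through them is the diagonal. -/
theorem eq_of_coeff_eq_zero {p p' q q' : ℂ} (hp : p ≠ 1) (hq : q ≠ 1) (hq' : q' ≠ 1)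
    (hqq' : q ≠ q') (h₀ : (p - 1) * (q' - 1) = (p' - 1) * (q - 1))
    (h₃ : q * p' - p * q * p' - p * q' + p * q * q' + p * p' * q' - q * p' * q' = 0) :
    p = q ∧ p' = q' := by
  have hX : p - 1 ≠ 0 := sub_ne_zero.2 hp
  have hx : q - 1 ≠ 0 := sub_ne_zero.2 hq
  have hy : q' - 1 ≠ 0 := sub_ne_zero.2 hq'
  have hyx : q' - q ≠ 0 := sub_ne_zero.2 (Ne.symm hqq')
  have hp' : p' = 1 + (p - 1) * (q' - 1) / (q - 1) := by
    field_simp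
    linear_combination -h₀
  have key : (q' - 1) * (q' - q) * (p - 1) * (p - q) = 0 := by
    rw [hp'] at h₃
    field_simp at h₃
    linear_combination h₃
  have hpq : p = q := by
    rw [← sub_eq_zero]
    simpa [hX, hy, hyx] using key
  refine ⟨hpq, ?_⟩
  rw [hp', hpq]
  field_simp
  ring

/-! ### Cubics containing the seven lines -/

namespace SevenLines

/-- A form of degree `3` that vanishes on the seven lines is, in adapted coordinates, the sum of
forms of bidegrees `(1, 2)` and `(2, 1)` in `(z₁, z₃)` and `(z₂, z₄)`. Both vanish in five points
of `ℙ¹ × ℙ¹`; two of these conditions are used up by the missing monomials, and the other three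
are those listed here. -/
theorem IsAdapted.exists_coefficients {L : SevenLines} {e : (Fin 4 → ℂ) ≃ₗ[ℂ] (Fin 4 → ℂ)}
    (he : L.IsAdapted e) {F : MvPolynomial (Fin 4) ℂ} (hF : F.IsHomogeneous 3) (hL : L.LieOn F) :
    ∃ m₀ m₁ m₂ m₃ n₀ n₁ n₂ n₃ : ℂ,
      (∀ x, MvPolynomial.eval x F = m₀ * (e x 2 * e x 1 ^ 2) + m₁ * (e x 0 * e x 1 * e x 3)
        + m₂ * (e x 2 * e x 1 * e x 3) + m₃ * (e x 0 * e x 3 ^ 2)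
        + n₀ * (e x 1 * e x 2 ^ 2) + n₁ * (e x 1 * e x 0 * e x 2)
        + n₂ * (e x 3 * e x 0 * e x 2) + n₃ * (e x 3 * e x 0 ^ 2)) ∧
      (m₀ + m₁ + m₂ + m₃ = 0 ∧
        L.alpha ^ 2 * m₀ + L.alpha * L.alpha' * m₁ + L.alpha * m₂ + L.alpha' * m₃ = 0 ∧
        L.beta ^ 2 * m₀ + L.beta * L.beta' * m₁ + L.beta * m₂ + L.beta' * m₃ = 0) ∧
      (n₀ + n₁ + n₂ + n₃ = 0 ∧
        L.alpha * n₀ + L.alpha * L.alpha' * n₁ + L.alpha' * n₂ + L.alpha' ^ 2 * n₃ = 0 ∧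
        L.beta * n₀ + L.beta * L.beta' * n₁ + L.beta' * n₂ + L.beta' ^ 2 * n₃ = 0) := by
  obtain ⟨φ, hφ, hFφ, -⟩ := hF.exists_trilinear
  set E : Fin 4 → Fin 4 → ℂ := fun i => e.symm (Pi.single i 1) with hE
  obtain ⟨⟨hb5, hb6, hc, h0, h1, h2, h3⟩, -⟩ := he.lines_eq (E := E) fun i => rfl
  have hx : ∀ x, x = (e x 1 • E 1 + e x 3 • E 3) + (e x 0 • E 0 + e x 2 • E 2) := by
    intro x
    apply e.injective
    simp only [map_add, map_smul, hE, LinearEquiv.apply_symm_apply]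
    conv_lhs => rw [pi_eq_sum_univ' (e x), Fin.sum_univ_four]
    module
  have line : ∀ {l : Submodule ℂ (Fin 4 → ℂ)} {p q : Fin 4 → ℂ}, ContainsLine F l →
      l = Submodule.span ℂ {p, q} → φ p p p = 0 ∧ φ p p q = 0 ∧ φ p q q = 0 ∧ φ q q q = 0 := by
    rintro l p q hl rfl
    refine (hφ.cube_combo_eq_zero_iff p q).1 fun a b => ?_
    rw [← hFφ]
    exact containsLine_span_pair_iff.1 hl a b
  obtain ⟨hL5, hL6, hLc, hLa⟩ := hL
  have k5 := ((hφ.cube_combo_eq_zero_iff _ _).2 (line hL5 hb5))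
  have k6 := ((hφ.cube_combo_eq_zero_iff _ _).2 (line hL6 hb6))
  obtain ⟨-, c1, c2, -⟩ := line hLc hc
  obtain ⟨-, a1, a2, -⟩ := line (hLa 0) h0
  -- these rules sort the arguments of `φ`
  have s₁₂ : ∀ x, φ (E 1) (E 0) x = φ (E 0) (E 1) x ∧
      φ (E 2) (E 0) x = φ (E 0) (E 2) x ∧
      φ (E 3) (E 0) x = φ (E 0) (E 3) x ∧
      φ (E 2) (E 1) x = φ (E 1) (E 2) x ∧
      φ (E 3) (E 1) x = φ (E 1) (E 3) x ∧
      φ (E 3) (E 2) x = φ (E 2) (E 3) x :=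
    fun x => ⟨hφ.swap₁₂ _ _ _, hφ.swap₁₂ _ _ _, hφ.swap₁₂ _ _ _,
      hφ.swap₁₂ _ _ _, hφ.swap₁₂ _ _ _, hφ.swap₁₂ _ _ _⟩
  have s₂₃ : ∀ x, φ x (E 1) (E 0) = φ x (E 0) (E 1) ∧
      φ x (E 2) (E 0) = φ x (E 0) (E 2) ∧
      φ x (E 3) (E 0) = φ x (E 0) (E 3) ∧
      φ x (E 2) (E 1) = φ x (E 1) (E 2) ∧
      φ x (E 3) (E 1) = φ x (E 1) (E 3) ∧
      φ x (E 3) (E 2) = φ x (E 2) (E 3) :=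
    fun x => ⟨hφ.swap₂₃ _ _ _, hφ.swap₂₃ _ _ _, hφ.swap₂₃ _ _ _,
      hφ.swap₂₃ _ _ _, hφ.swap₂₃ _ _ _, hφ.swap₂₃ _ _ _⟩
  have conds : ∀ t s : ℂ, φ (t • E 1 + E 3) (t • E 1 + E 3) (s • E 0 + E 2) = 0 →
      φ (t • E 1 + E 3) (s • E 0 + E 2) (s • E 0 + E 2) = 0 →
      t ^ 2 * (3 * φ (E 1) (E 1) (E 2)) + t * s * (6 * φ (E 0) (E 1) (E 3))
        + t * (6 * φ (E 1) (E 2) (E 3)) + s * (3 * φ (E 0) (E 3) (E 3)) = 0 ∧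
      t * (3 * φ (E 1) (E 2) (E 2)) + t * s * (6 * φ (E 0) (E 1) (E 2))
        + s * (6 * φ (E 0) (E 2) (E 3)) + s ^ 2 * (3 * φ (E 0) (E 0) (E 3)) = 0 := by
    intro t s k1 k2
    simp only [map_add, map_smul, LinearMap.add_apply, LinearMap.smul_apply, smul_eq_mul,
      s₁₂, s₂₃] at k1 k2 c1 c2 a1 a2
    constructor
    · linear_combination 3 * k1 - 3 * t ^ 2 * s * c1 - 3 * a1
    · linear_combination 3 * k2 - 3 * t * s ^ 2 * c2 - 3 * a2
  obtain ⟨-, q1, q2, -⟩ := line (hLa 1) h1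
  obtain ⟨-, q3, q4, -⟩ := line (hLa 2) h2
  obtain ⟨-, q5, q6, -⟩ := line (hLa 3) h3
  obtain ⟨r1, r2⟩ := conds 1 1 (by simpa only [one_smul] using q1)
    (by simpa only [one_smul] using q2)
  obtain ⟨r3, r4⟩ := conds _ _ q3 q4
  obtain ⟨r5, r6⟩ := conds _ _ q5 q6
  refine ⟨3 * φ (E 1) (E 1) (E 2), 6 * φ (E 0) (E 1) (E 3), 6 * φ (E 1) (E 2) (E 3),
    3 * φ (E 0) (E 3) (E 3), 3 * φ (E 1) (E 2) (E 2), 6 * φ (E 0) (E 1) (E 2),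
    6 * φ (E 0) (E 2) (E 3), 3 * φ (E 0) (E 0) (E 3), fun x => ?_,
    ⟨by linear_combination r1, r3, r5⟩, ⟨by linear_combination r2, r4, r6⟩⟩
  rw [hFφ]
  conv_lhs => rw [hx x]
  have hcube := hφ.cube_combo 1 1 (e x 1 • E 1 + e x 3 • E 3) (e x 0 • E 0 + e x 2 • E 2)
  simp only [one_smul] at hcube
  rw [hcube, k5, k6]
  simp only [map_add, map_smul, LinearMap.add_apply, LinearMap.smul_apply, smul_eq_mul,
    s₁₂, s₂₃] at c1 c2 a1 a2 ⊢
  linear_combination 3 * e x 1 ^ 2 * e x 0 * c1 + 3 * e x 1 * e x 0 ^ 2 * c2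
    + 3 * e x 3 ^ 2 * e x 2 * a1 + 3 * e x 3 * e x 2 ^ 2 * a2

end SevenLines

namespace SevenLines

/-- If the cross ratios on `b₅` and `b₆` agree, then all seven lines lie on the quadric
`z₁ z₄ = z₂ z₃`. Every cubic containing the lines consists of this quadric and a plane, and is
singular along their intersection. -/
theorem IsAdapted.not_cross_ratios_eq {L : SevenLines} {e : (Fin 4 → ℂ) ≃ₗ[ℂ] (Fin 4 → ℂ)}
    (he : L.IsAdapted e) {F : MvPolynomial (Fin 4) ℂ} (hF : IsNonsingularCubic F)
    (hL : L.LieOn F) : ¬ (L.alpha = L.alpha' ∧ L.beta = L.beta') := by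
  rintro ⟨hα, -⟩
  obtain ⟨m₀, m₁, m₂, m₃, n₀, n₁, n₂, n₃, hFx, ⟨h1, h2, -⟩, ⟨k1, k2, -⟩⟩ :=
    he.exists_coefficients hF.1.2 hL
  obtain ⟨-, hα0, hα1, -⟩ := he.lines_eq fun _ => rfl
  rw [← hα] at h2 k2
  have hα1' : L.alpha - 1 ≠ 0 := sub_ne_zero.2 hα1
  have hm : m₀ + m₁ = 0 := by
    apply mul_left_cancel₀ (mul_ne_zero hα0 hα1')
    linear_combination h2 - L.alpha * h1
  have hn : n₁ + n₃ = 0 := by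
    apply mul_left_cancel₀ (mul_ne_zero hα0 hα1')
    linear_combination k2 - L.alpha * k1
  have hm₁ : m₁ = -m₀ := by linear_combination hm
  have hm₃ : m₃ = -m₂ := by linear_combination h1 - hm
  have hn₂ : n₂ = -n₀ := by linear_combination k1 - hn
  have hn₃ : n₃ = -n₁ := by linear_combination hn
  -- a point of `a₁`, hence of the quadric, in the residual plane
  obtain ⟨r, s, hrs, hplane⟩ : ∃ r s : ℂ, (r ≠ 0 ∨ s ≠ 0) ∧ n₀ * r + m₂ * s = 0 := by
    by_cases h0 : m₂ = 0 ∧ n₀ = 0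
    · exact ⟨1, 0, by simp, by rw [h0.2]; ring⟩
    · exact ⟨m₂, -n₀, by rw [neg_ne_zero]; tauto, by ring⟩
  have hx0 : e.symm ![0, 0, r, s] ≠ 0 := by
    rw [Ne, LinearEquiv.map_eq_zero_iff]
    intro h0
    have e2 := congrFun h0 2
    have e3 := congrFun h0 3
    simp at e2 e3
    tauto
  obtain ⟨v, hv⟩ := hF.exists_second_difference_ne_zero hx0
  apply hv
  rw [hFx, hFx, hFx]
  simp only [map_add, map_sub, LinearEquiv.apply_symm_apply, Pi.add_apply, Pi.sub_apply, hm₁, hm₃,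
    hn₂, hn₃, Matrix.cons_val]
  linear_combination (2 * r * e v 1 - 2 * s * e v 0) * hplane

/-- The equations of the seven lines in adapted coordinates. -/
theorem IsAdapted.lieOn_pullbackForm {L : SevenLines} {e : (Fin 4 → ℂ) ≃ₗ[ℂ] (Fin 4 → ℂ)}
    (he : L.IsAdapted e) {C : MvPolynomial (Fin 4) ℂ}
    (h₁₃ : ∀ x y, MvPolynomial.eval ![0, x, 0, y] C = 0)
    (h₀₂ : ∀ x y, MvPolynomial.eval ![x, 0, y, 0] C = 0)
    (h₀₁ : ∀ x y, MvPolynomial.eval ![x, y, 0, 0] C = 0)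
    (h₂₃ : ∀ x y, MvPolynomial.eval ![0, 0, x, y] C = 0)
    (h₁ : ∀ x y, MvPolynomial.eval ![x, y, x, y] C = 0)
    (hα : ∀ x y, MvPolynomial.eval ![x, y, L.alpha'⁻¹ * x, L.alpha⁻¹ * y] C = 0)
    (hβ : ∀ x y, MvPolynomial.eval ![x, y, L.beta'⁻¹ * x, L.beta⁻¹ * y] C = 0) :
    L.LieOn (pullbackForm e C) := by
  set E : Fin 4 → Fin 4 → ℂ := fun i => e.symm (Pi.single i 1) with hE
  obtain ⟨⟨hb5, hb6, hc, h0, h1, h2, h3⟩, nα, -, nα', -, nβ, -, nβ', -⟩ :=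
    he.lines_eq (E := E) fun i => rfl
  have hEi : ∀ i j, e (E i) j = if j = i then 1 else 0 := by
    intro i j
    rw [hE, LinearEquiv.apply_symm_apply, Pi.single_apply]
  have key : ∀ {l : Submodule ℂ (Fin 4 → ℂ)} {t s : ℂ}, t ≠ 0 → s ≠ 0 →
      l = Submodule.span ℂ {t • E 1 + E 3, s • E 0 + E 2} →
      (∀ x y, MvPolynomial.eval ![x, y, s⁻¹ * x, t⁻¹ * y] C = 0) →
      ContainsLine (pullbackForm e C) l := by
    rintro l t s ht hs rfl hC
    rw [containsLine_span_pair_iff]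
    intro a b
    rw [eval_pullbackForm]
    convert hC (b * s) (a * t)
    funext i
    fin_cases i <;> simp [hEi]
    · field_simp
    · field_simp
  have key' : ∀ {l : Submodule ℂ (Fin 4 → ℂ)} {i j : Fin 4}, l = Submodule.span ℂ {E i, E j} →
      (∀ x y : ℂ, MvPolynomial.eval (Pi.single i x + Pi.single j y) C = 0) →
      ContainsLine (pullbackForm e C) l := by
    rintro l i j rfl hC
    rw [containsLine_span_pair_iff]
    intro a b
    rw [eval_pullbackForm]
    convert hC a b
    simp [hE, ← Pi.single_smul]
  refine ⟨key' hb5 fun x y => ?_, key' hb6 fun x y => ?_, key' hc fun x y => ?_, ?_⟩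
  · convert h₁₃ x y
    funext i
    fin_cases i <;> simp
  · convert h₀₂ x y
    funext i
    fin_cases i <;> simp
  · convert h₀₁ y x
    funext i
    fin_cases i <;> simp
  · rw [Fin.forall_fin_succ, Fin.forall_fin_succ, Fin.forall_fin_two]
    refine ⟨key' h0 fun x y => ?_, key one_ne_zero one_ne_zero ?_ fun x y => ?_, key nα nα' h2 hα,
      key nβ nβ' h3 hβ⟩
    · convert h₂₃ y x
      funext i
      fin_cases i <;> simp
    · rw [one_smul, one_smul]
      exact h1
    · rw [inv_one, one_mul, one_mul]
      exact h₁ x y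

theorem IsAdapted.lieOn {L : SevenLines} {e : (Fin 4 → ℂ) ≃ₗ[ℂ] (Fin 4 → ℂ)}
    (he : L.IsAdapted e) : L.LieOn (L.cubicOne e) ∧ L.LieOn (L.cubicTwo e) := by
  constructor <;> apply he.lieOn_pullbackForm <;> intro x y <;>
    simp only [eval_explicitCubicOne, eval_explicitCubicTwo, Matrix.cons_val] <;> ring

theorem IsAdapted.isHomogeneous_and_lieOn {L : SevenLines}
    {e : (Fin 4 → ℂ) ≃ₗ[ℂ] (Fin 4 → ℂ)} (he : L.IsAdapted e) {F : MvPolynomial (Fin 4) ℂ}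
    (hF : F ∈ L.pencil e) : F.IsHomogeneous 3 ∧ L.LieOn F := by
  obtain ⟨a, b, rfl⟩ := Submodule.mem_span_pair.1 hF
  constructor
  · exact ((MvPolynomial.homogeneousSubmodule (Fin 4) ℂ 3).smul_mem a
      (pullbackForm_isHomogeneous e (explicitCubicOne_isHomogeneous ..))).add
      ((MvPolynomial.homogeneousSubmodule (Fin 4) ℂ 3).smul_mem b
      (pullbackForm_isHomogeneous e (explicitCubicTwo_isHomogeneous ..)))
  · have comb : ∀ l, ContainsLine (L.cubicOne e) l → ContainsLine (L.cubicTwo e) l →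
        ContainsLine (a • L.cubicOne e + b • L.cubicTwo e) l := by
      intro l h1 h2 x hx
      rw [map_add, MvPolynomial.smul_eval, MvPolynomial.smul_eval, h1 x hx, h2 x hx]
      ring
    obtain ⟨⟨h1, h2, h3, h4⟩, ⟨k1, k2, k3, k4⟩⟩ := he.lieOn
    exact ⟨comb _ h1 k1, comb _ h2 k2, comb _ h3 k3, fun i => comb _ (h4 i) (k4 i)⟩

theorem eval_pencil (L : SevenLines) (e : (Fin 4 → ℂ) ≃ₗ[ℂ] (Fin 4 → ℂ)) (a b : ℂ)
    (x : Fin 4 → ℂ) : MvPolynomial.eval x (a • L.cubicOne e + b • L.cubicTwo e) =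
      a * MvPolynomial.eval (e x) (explicitCubicOne L.alpha'⁻¹ L.beta'⁻¹ L.alpha⁻¹ L.beta⁻¹)
      + b * MvPolynomial.eval (e x)
        (explicitCubicTwo L.alpha'⁻¹ L.beta'⁻¹ L.alpha⁻¹ L.beta⁻¹) := by
  rw [map_add, MvPolynomial.smul_eval, MvPolynomial.smul_eval, cubicOne, cubicTwo,
    eval_pullbackForm, eval_pullbackForm]

/-- If the seven lines lie on a non-singular cubic, then both explicit cubics are non-zero, and
they span the space of all cubic forms that vanish on the lines. -/
theorem IsAdapted.linearIndependent_and_mem_pencil {L : SevenLines}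
    {e : (Fin 4 → ℂ) ≃ₗ[ℂ] (Fin 4 → ℂ)} (he : L.IsAdapted e)
    (hns : ∃ F, IsNonsingularCubic F ∧ L.LieOn F) :
    LinearIndependent ℂ ![L.cubicOne e, L.cubicTwo e] ∧
      ∀ F, IsCubic F → L.LieOn F → F ∈ L.pencil e := by
  obtain ⟨-, hα, hα1, hα', hα1', hβ, hβ1, hβ', hβ1', hαβ, hαβ'⟩ :=
    he.lines_eq fun _ => rfl
  have hdiag : ¬ (L.alpha = L.alpha' ∧ L.beta = L.beta') := by
    obtain ⟨F, hF, hL⟩ := hns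
    exact he.not_cross_ratios_eq hF hL
  have hmem := fun F (hF : IsCubic F) (hL : L.LieOn F) => he.exists_coefficients hF.2 hL
  have hev := L.eval_pencil e
  rw [LinearIndependent.pair_iff]
  unfold pencil
  simp only [Submodule.mem_span_pair]
  set p := L.alpha'⁻¹ with hp
  set p' := L.beta'⁻¹ with hp'
  set q := L.alpha⁻¹ with hq
  set q' := L.beta⁻¹ with hq'
  have np : p ≠ 0 := inv_ne_zero hα'
  have np' : p' ≠ 0 := inv_ne_zero hβ'
  have nq : q ≠ 0 := inv_ne_zero hα
  have nq' : q' ≠ 0 := inv_ne_zero hβ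
  have np1 : p ≠ 1 := by rwa [hp, Ne, inv_eq_one]
  have nq1 : q ≠ 1 := by rwa [hq, Ne, inv_eq_one]
  have nq1' : q' ≠ 1 := by rwa [hq', Ne, inv_eq_one]
  have nqq' : q ≠ q' := by rwa [hq, hq', Ne, inv_inj]
  have hne : ¬ ((p - 1) * (q' - 1) = (p' - 1) * (q - 1) ∧
      q * p' - p * q * p' - p * q' + p * q * q' + p * p' * q' - q * p' * q' = 0) := by
    rintro ⟨h0, h3⟩
    obtain ⟨e1, e2⟩ := eq_of_coeff_eq_zero np1 nq1 nq1' nqq' h0 h3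
    exact hdiag ⟨(inv_injective e1).symm, (inv_injective e2).symm⟩
  have hne1 : -p * q * q' + q ^ 2 * q' + q * p' * q' - q ^ 2 * p' * q' - q * q' ^ 2
        + p * q * q' ^ 2 ≠ 0 ∨
      q * p' - p * q * p' - p * q' + p * q * q' + p * p' * q' - q * p' * q' ≠ 0 := by
    by_contra! hc
    refine hne ⟨mul_left_cancel₀ (mul_ne_zero nq nq') ?_, hc.2⟩
    linear_combination hc.1
  have hne2 : -q * p' + p * q * p' + p * q' - p * q * q' - p * p' * q' + q * p' * q' ≠ 0 ∨
      p ^ 2 * p' - p * q * p' - p * p' ^ 2 + p * q * p' ^ 2 + p * p' * q'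
        - p ^ 2 * p' * q' ≠ 0 := by
    by_contra! hc
    refine hne ⟨mul_left_cancel₀ (mul_ne_zero np np') ?_, by linear_combination -hc.1⟩
    linear_combination -hc.2
  constructor
  · intro a b hab
    have hz : ∀ z, a * MvPolynomial.eval z (explicitCubicOne p p' q q')
        + b * MvPolynomial.eval z (explicitCubicTwo p p' q q') = 0 := by
      intro z
      have := hev a b (e.symm z)
      rw [hab, map_zero, LinearEquiv.apply_symm_apply] at this
      exact this.symm
    have z1 := hz ![0, 1, 1, 0]
    have z2 := hz ![0, 1, -1, 0]
    have z3 := hz ![1, 0, 0, 1]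
    have z4 := hz ![1, 0, 0, -1]
    simp only [eval_explicitCubicOne, eval_explicitCubicTwo, Matrix.cons_val] at z1 z2 z3 z4
    constructor
    · rcases hne1 with h | h
      · apply (mul_eq_zero.1 _).resolve_right h
        linear_combination (1 / 2) * z1 - (1 / 2) * z2
      · apply (mul_eq_zero.1 _).resolve_right h
        linear_combination (1 / 2) * z3 + (1 / 2) * z4
    · rcases hne2 with h | h
      · apply (mul_eq_zero.1 _).resolve_right h
        linear_combination (1 / 2) * z1 + (1 / 2) * z2
      · apply (mul_eq_zero.1 _).resolve_right h
        linear_combination (1 / 2) * z3 - (1 / 2) * z4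
  · intro F hF hL
    obtain ⟨m₀, m₁, m₂, m₃, n₀, n₁, n₂, n₃, hFx, ⟨h1, h2, h3⟩, ⟨k1, k2, k3⟩⟩ := hmem F hF hL
    have iα : L.alpha * q = 1 := mul_inv_cancel₀ hα
    have iα' : L.alpha' * p = 1 := mul_inv_cancel₀ hα'
    have iβ : L.beta * q' = 1 := mul_inv_cancel₀ hβ
    have iβ' : L.beta' * p' = 1 := mul_inv_cancel₀ hβ'
    -- rewrite the conditions in terms of the inverses of the cross ratios
    have cond1 : ∀ {t s p q : ℂ}, t * q = 1 → s * p = 1 →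
        t ^ 2 * m₀ + t * s * m₁ + t * m₂ + s * m₃ = 0 →
        p * m₀ + q * m₁ + p * q * m₂ + q ^ 2 * m₃ = 0 := by
      intro t s p q ht hs h
      have ht0 : t ≠ 0 := left_ne_zero_of_mul_eq_one ht
      have hs0 : s ≠ 0 := left_ne_zero_of_mul_eq_one hs
      obtain rfl := eq_inv_of_mul_eq_one_right ht
      obtain rfl := eq_inv_of_mul_eq_one_right hs
      field_simp
      linear_combination h
    have cond2 : ∀ {t s p q : ℂ}, t * q = 1 → s * p = 1 →
        t * n₀ + t * s * n₁ + s * n₂ + s ^ 2 * n₃ = 0 →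
        p ^ 2 * n₀ + p * n₁ + p * q * n₂ + q * n₃ = 0 := by
      intro t s p q ht hs h
      have ht0 : t ≠ 0 := left_ne_zero_of_mul_eq_one ht
      have hs0 : s ≠ 0 := left_ne_zero_of_mul_eq_one hs
      obtain rfl := eq_inv_of_mul_eq_one_right ht
      obtain rfl := eq_inv_of_mul_eq_one_right hs
      field_simp
      linear_combination h
    obtain ⟨a, rfl, rfl, rfl, rfl⟩ :=
      exists_eq_mul_coeff_one h1 (cond1 iα iα' h2) (cond1 iβ iβ' h3) hne1
    obtain ⟨b, rfl, rfl, rfl, rfl⟩ :=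
      exists_eq_mul_coeff_two k1 (cond2 iα iα' k2) (cond2 iβ iβ' k3) hne2
    refine ⟨a, b, MvPolynomial.funext fun x => ?_⟩
    rw [hev, hFx, eval_explicitCubicOne, eval_explicitCubicTwo]
    ring

/-- A non-singular member of the pencil is none of the two explicit cubics: these are singular in
the points of `b₆`, respectively of `b₅`. -/
theorem coeff_ne_zero_of_isNonsingularCubic (L : SevenLines)
    (e : (Fin 4 → ℂ) ≃ₗ[ℂ] (Fin 4 → ℂ)) {a b : ℂ}
    (hF : IsNonsingularCubic (a • L.cubicOne e + b • L.cubicTwo e)) : a ≠ 0 ∧ b ≠ 0 := by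
  have hx : ∀ i, e.symm (Pi.single i 1) ≠ 0 := fun i => by
    rw [Ne, LinearEquiv.map_eq_zero_iff]
    simp
  constructor
  · rintro rfl
    obtain ⟨v, hv⟩ := hF.exists_second_difference_ne_zero (hx 1)
    apply hv
    rw [eval_pencil, eval_pencil, eval_pencil]
    simp only [map_add, map_sub, LinearEquiv.apply_symm_apply, eval_explicitCubicTwo,
      Pi.add_apply, Pi.sub_apply, Pi.single_apply, Fin.reduceEq, if_true, if_false]
    ring
  · rintro rfl
    obtain ⟨v, hv⟩ := hF.exists_second_difference_ne_zero (hx 0)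
    apply hv
    rw [eval_pencil, eval_pencil, eval_pencil]
    simp only [map_add, map_sub, LinearEquiv.apply_symm_apply, eval_explicitCubicOne,
      Pi.add_apply, Pi.sub_apply, Pi.single_apply, Fin.reduceEq, if_true, if_false]
    ring

/-- Scaling `z₁` and `z₃` by `s` multiplies the first explicit cubic by `s` and the second one by
`s²`, so that any ratio of the two coefficients can be achieved. -/
theorem projectivelyIsomorphic_of_mem_pencil (L : SevenLines)
    (e : (Fin 4 → ℂ) ≃ₗ[ℂ] (Fin 4 → ℂ)) {F G : MvPolynomial (Fin 4) ℂ} (hF : F ∈ L.pencil e)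
    (hG : G ∈ L.pencil e) (hFns : IsNonsingularCubic F) (hGns : IsNonsingularCubic G) :
    ProjectivelyIsomorphic F G := by
  obtain ⟨a, b, rfl⟩ := Submodule.mem_span_pair.1 hF
  obtain ⟨c, d, rfl⟩ := Submodule.mem_span_pair.1 hG
  obtain ⟨ha, hb⟩ := L.coeff_ne_zero_of_isNonsingularCubic e hFns
  obtain ⟨hc, hd⟩ := L.coeff_ne_zero_of_isNonsingularCubic e hGns
  have hs : c * b / (a * d) ≠ 0 := div_ne_zero (mul_ne_zero hc hb) (mul_ne_zero ha hd)
  let σ : Fin 4 → ℂˣ := ![Units.mk0 _ hs, 1, Units.mk0 _ hs, 1]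
  let D : (Fin 4 → ℂ) ≃ₗ[ℂ] (Fin 4 → ℂ) :=
    LinearEquiv.piCongrRight fun i => LinearEquiv.smulOfUnit (σ i)
  have hD : ∀ z i, D z i = σ i * z i := fun z i => rfl
  refine ⟨e.trans (D.trans e.symm), c * (c * b / (a * d)) / a,
    div_ne_zero (mul_ne_zero hc hs) ha, MvPolynomial.funext fun x => ?_⟩
  rw [eval_pullbackForm, MvPolynomial.smul_eval, eval_pencil, eval_pencil, eval_explicitCubicOne,
    eval_explicitCubicTwo, eval_explicitCubicOne, eval_explicitCubicTwo]
  simp only [LinearEquiv.trans_apply, LinearEquiv.apply_symm_apply, hD, σ, Matrix.cons_val,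
    Units.val_mk0, Units.val_one]
  field_simp

end SevenLines

theorem mainTheorem3 :
    (∀ L : SevenLines,
      (∃ e : (Fin 4 → ℂ) ≃ₗ[ℂ] (Fin 4 → ℂ), L.IsAdapted e) ∧
      ∀ e : (Fin 4 → ℂ) ≃ₗ[ℂ] (Fin 4 → ℂ), L.IsAdapted e →
        (∀ F ∈ L.pencil e, F.IsHomogeneous 3 ∧ L.LieOn F) ∧
        ((∃ F, IsNonsingularCubic F ∧ L.LieOn F) →
          LinearIndependent ℂ ![L.cubicOne e, L.cubicTwo e] ∧
          ∀ F, IsCubic F → L.LieOn F → F ∈ L.pencil e) ∧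
        (∀ F ∈ L.pencil e, ∀ G ∈ L.pencil e,
          IsNonsingularCubic F → IsNonsingularCubic G → ProjectivelyIsomorphic F G)) ∧
    (∀ F : MvPolynomial (Fin 4) ℂ, IsNonsingularCubic F →
      ∃ L : SevenLines, L.LieOn F ∧
        ∃ e : (Fin 4 → ℂ) ≃ₗ[ℂ] (Fin 4 → ℂ), L.IsAdapted e ∧ F ∈ L.pencil e) := by
  refine ⟨fun L => ⟨L.exists_isAdapted, fun e he => ⟨fun F hF => he.isHomogeneous_and_lieOn hF,
    he.linearIndependent_and_mem_pencil, fun F hF G hG hFns hGns =>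
      L.projectivelyIsomorphic_of_mem_pencil e hF hG hFns hGns⟩⟩, fun F hF => ?_⟩
  obtain ⟨φ, hφ, h1, h2⟩ := hF.1.2.exists_trilinear
  have hns := hF.isNonsingularForm h1 h2
  obtain ⟨l, hl⟩ := hns.exists_isLineOn hφ
  obtain ⟨L, h5, h6, hc, ha⟩ := hl.exists_sevenLines hφ hns
  have hcont : ∀ {m}, IsLineOn φ m → ContainsLine F m := fun hm x hx => by rw [h1, hm.2 x hx]
  have hL : L.LieOn F := ⟨hcont h5, hcont h6, hcont hc, fun i => hcont (ha i)⟩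
  obtain ⟨e, he⟩ := L.exists_isAdapted
  exact ⟨L, hL, e, he, (he.linearIndependent_and_mem_pencil ⟨F, hF, hL⟩).2 F hF.1 hL⟩
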